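/- Let $(W,S)$ be a Coxeter system ($W$ and $S$ may be infinite), let $\Gamma$ be a totally ordered abelian group, and let $\varphi : S \to \Gamma$ be a map that takes the same value on any two elements of $S$ that are conjugate in $W$. Let $\mathcal H(W,S,\varphi)$ be the Hecke algebra over $\mathbb Z[\Gamma]=\bigoplus_{\gamma\in\Gamma}\mathbb Z e^{\gamma}$ with basis $(T_w)_{w\in W}$ and relations $T_wT_{w'}=T_{ww'}$ if $\ell(ww')=\ell(w)+\ell(w')$, and $(T_s-e^{\varphi(s)})(T_s+e^{-\varphi(s)})=0$ for $s\in S$. Let $h\mapsto\overline h$ be the ring involution with $\overline{e^\gamma}=e^{-\gamma}$, $\overline{T_w}=T_{w^{-1}}^{-1}$, and let $(C_w)_{w\in W}$ be the Kazhdan–Lusztig basis: $\overline{C_w}=C_w$ and $C_w\equiv T_w$ modulo $\bigoplus_{y}\mathbb Z[\Gamma_{<0}]T_y$. Let $\leqslant_L$ be the transitive closure of the relation "$C_x$ occurs with non-zero coefficient in $hC_y$ for some $h\in\mathcal H(W,S,\varphi)$"; left cells are the classes of the associated equivalence relation. For a left cell $C$ put $M_C=\bigl(\bigoplus_{w\leqslant_L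 C}\mathbb Z[\Gamma]C_w\bigr)/\bigl(\bigoplus_{w\leqslant_L C,\,w\notin C}\mathbb Z[\Gamma]C_w\bigr)$, a left $\mathcal H(W,S,\varphi)$-module, and let $\mathbb Z M_C=\mathbb Z\otimes_{\mathbb Z[\Gamma]}M_C$ (where $\mathbb Z[\Gamma]\to\mathbb Z$, $e^\gamma\mapsto 1$), a module over $\mathbb Z\otimes_{\mathbb Z[\Gamma]}\mathcal H(W,S,\varphi)=\mathbb ZW$. Let $S=I\sqcup J$ be a partition such that no element of $I$ is conjugate in $W$ to an element of $J$, and assume that $\varphi(s)=0$ for all $s\in I$. Let $W_I=\langle I\rangle$, $\tilde J=\{wtw^{-1} : w\in W_I,\ t\in J\}$, $\tilde W=\langle\tilde J\rangle$, and for $\tilde t\in\tilde J$ let $\tilde\varphi(\tilde t)=\varphi(t)$, where $t\in J$ is $W_I$-conjugate to $\tilde t$. Then $(\tilde W,\tilde J)$ is a Coxeter system and $\tilde\varphi$ takes the same value on elements of $\tilde J$ that are conjugate in $\tilde W$. Moreover, if $C$ is a left cell for $(\tilde W,\tilde J,\tilde\varphi)$, then $W_I\cdot C=\{ax : a\in W_I,\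 x\in C\}$ is a left cell for $(W,S,\varphi)$ and there is an isomorphism of $\mathbb ZW$-modules $$\mathbb Z M_{W_I\cdot C}\;\simeq\;\operatorname{Ind}_{\tilde W}^{W}\,\mathbb Z M_C .$$ -/

import Mathlib

open scoped TensorProduct Pointwise

noncomputable section

namespace KLCells

/-! ### The group ring `ℤ[Γ]` -/

section GroupRing

variable (Γ : Type*) [AddCommGroup Γ]

/-- The group ring `ℤ[Γ] = ⨁_γ ℤ e^γ`. -/
abbrev GroupRing : Type _ := AddMonoidAlgebra ℤ Γ

variable {Γ}

/-- The basis element `e^γ` of `ℤ[Γ]`. -/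
def expo (γ : Γ) : GroupRing Γ := AddMonoidAlgebra.single γ 1

variable (Γ)

/-- The involution `e^γ ↦ e^{-γ}` of `ℤ[Γ]`. -/
def barScalar : GroupRing Γ →+* GroupRing Γ :=
  AddMonoidAlgebra.mapDomainRingHom ℤ (negAddMonoidHom : Γ →+ Γ)

/-- The augmentation `ℤ[Γ] → ℤ`, `e^γ ↦ 1`. -/
def aug : GroupRing Γ →+* ℤ :=
  (AddMonoidAlgebra.lift ℤ ℤ Γ 1).toRingHom

/-- The abelian group `ℤ`, seen as a `ℤ[Γ]`-module through the augmentation. -/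
@[nolint unusedArguments]
def AugInt (_ : Type*) : Type := ℤ

instance : AddCommGroup (AugInt Γ) := inferInstanceAs (AddCommGroup ℤ)

instance : Module (GroupRing Γ) (AugInt Γ) := Module.compHom ℤ (aug Γ)

variable {Γ}

theorem expo_mul (a b : Γ) : expo a * expo b = expo (a + b) := by
  simp [expo, AddMonoidAlgebra.single_mul_single]

theorem expo_zero : expo (0 : Γ) = 1 := rfl

theorem barScalar_expo (a : Γ) : barScalar Γ (expo a) = expo (-a) := by
  simp [expo, barScalar]

theorem aug_expo (a : Γ) : aug Γ (expo a) = 1 := by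
  simp [expo, aug]

theorem augInt_smul (a : GroupRing Γ) (n : AugInt Γ) :
    a • n = ((aug Γ a * (show ℤ from n) : ℤ) : AugInt Γ) := rfl

theorem expo_smul_augInt (a : Γ) (n : AugInt Γ) : expo a • n = n := by
  rw [augInt_smul, aug_expo]; exact one_mul (show ℤ from n)

end GroupRing

/-! ### Hecke algebras -/

section Hecke

variable {B W : Type*} [Group W] {M : CoxeterMatrix B} (cs : CoxeterSystem M W)
variable {Γ : Type*} [AddCommGroup Γ] (φ : B → Γ)

/-- `φ` is constant on the sets of simple reflections that are conjugate in `W`, i.e. it is a map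
on the set `S̄` of conjugacy classes of simple reflections. -/
def IsParameter : Prop :=
  ∀ i j : B, IsConj (cs.simple i) (cs.simple j) → φ i = φ j

/-- The defining relations of the Hecke algebra, between the generators `T_w`, `w ∈ W`. -/
inductive HeckeRel : FreeAlgebra (GroupRing Γ) W → FreeAlgebra (GroupRing Γ) W → Prop
  | one : HeckeRel (FreeAlgebra.ι _ 1) 1
  | mul (w w' : W) (h : cs.length (w * w') = cs.length w + cs.length w') :
      HeckeRel (FreeAlgebra.ι _ w * FreeAlgebra.ι _ w') (FreeAlgebra.ι _ (w * w'))
  | quad (i : B) :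
      HeckeRel
        ((FreeAlgebra.ι _ (cs.simple i) - algebraMap (GroupRing Γ) _ (expo (φ i))) *
          (FreeAlgebra.ι _ (cs.simple i) + algebraMap (GroupRing Γ) _ (expo (-φ i)))) 0

/-- The Hecke algebra `H(W, S, φ)`: the `ℤ[Γ]`-algebra given by the generators `T_w` (`w ∈ W`), with
`T_1 = 1`, `T_w T_{w'} = T_{ww'}` if `ℓ(ww') = ℓ(w) + ℓ(w')`, and
`(T_s - e^{φ(s)})(T_s + e^{-φ(s)}) = 0` for `s ∈ S`. For a Coxeter system and a parameter `φ` it is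
a free `ℤ[Γ]`-module with basis `(T_w)`. -/
def Hecke : Type _ := RingQuot (HeckeRel cs φ)

instance : Ring (Hecke cs φ) := inferInstanceAs (Ring (RingQuot (HeckeRel cs φ)))

instance : Algebra (GroupRing Γ) (Hecke cs φ) :=
  inferInstanceAs (Algebra (GroupRing Γ) (RingQuot (HeckeRel cs φ)))

/-- The canonical map onto the Hecke algebra. -/
def heckeMk : FreeAlgebra (GroupRing Γ) W →ₐ[GroupRing Γ] Hecke cs φ :=
  RingQuot.mkAlgHom (GroupRing Γ) (HeckeRel cs φ)

/-- The element `T_w`. -/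
def T (w : W) : Hecke cs φ := heckeMk cs φ (FreeAlgebra.ι _ w)

/-- The image of `e^γ` in the Hecke algebra. -/
abbrev E (γ : Γ) : Hecke cs φ := algebraMap (GroupRing Γ) (Hecke cs φ) (expo γ)

theorem heckeMk_rel {x y : FreeAlgebra (GroupRing Γ) W} (h : HeckeRel cs φ x y) :
    heckeMk cs φ x = heckeMk cs φ y := RingQuot.mkAlgHom_rel _ h

theorem T_one : T cs φ 1 = 1 := by
  simpa [T] using heckeMk_rel cs φ HeckeRel.one

theorem T_mul (w w' : W) (h : cs.length (w * w') = cs.length w + cs.length w') :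
    T cs φ w * T cs φ w' = T cs φ (w * w') := by
  simpa [T] using heckeMk_rel cs φ (HeckeRel.mul w w' h)

theorem T_quad (i : B) :
    (T cs φ (cs.simple i) - E cs φ (φ i)) * (T cs φ (cs.simple i) + E cs φ (-φ i)) = 0 := by
  simpa [T] using heckeMk_rel cs φ (HeckeRel.quad i)

theorem E_mul_neg (γ : Γ) : E cs φ γ * E cs φ (-γ) = 1 := by
  rw [← map_mul, expo_mul, add_neg_cancel, expo_zero, map_one]

theorem E_neg_mul (γ : Γ) : E cs φ (-γ) * E cs φ γ = 1 := by
  rw [← map_mul, expo_mul, neg_add_cancel, expo_zero, map_one]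

theorem E_comm (γ : Γ) (h : Hecke cs φ) : E cs φ γ * h = h * E cs φ γ :=
  Algebra.commutes _ _

theorem T_simple_sq (i : B) : T cs φ (cs.simple i) * T cs φ (cs.simple i) =
    1 + E cs φ (φ i) * T cs φ (cs.simple i) - E cs φ (-φ i) * T cs φ (cs.simple i) := by
  have h := T_quad cs φ i
  rw [sub_mul, mul_add, mul_add, E_mul_neg, ← E_comm] at h
  rw [← sub_eq_zero, ← h]
  abel

theorem isUnit_T_simple (i : B) : IsUnit (T cs φ (cs.simple i)) := by
  have h := T_simple_sq cs φ i
  refine ⟨⟨T cs φ (cs.simple i), T cs φ (cs.simple i) - E cs φ (φ i) + E cs φ (-φ i), ?_, ?_⟩, rfl⟩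
  · rw [mul_add, mul_sub, h, ← E_comm, ← E_comm]; abel
  · rw [add_mul, sub_mul, h]; abel

theorem isUnit_T (w : W) : IsUnit (T cs φ w) := by
  induction hn : cs.length w generalizing w with
  | zero => rw [cs.length_eq_zero_iff.1 hn, T_one]; exact isUnit_one
  | succ n ih =>
    have hw : w ≠ 1 := by rintro rfl; simp at hn
    obtain ⟨i, hi⟩ := cs.exists_leftDescent_of_ne_one hw
    have hi' := cs.isLeftDescent_iff.1 hi
    have hm : T cs φ (cs.simple i) * T cs φ (cs.simple i * w) = T cs φ w := by
      rw [T_mul, cs.simple_mul_simple_cancel_left]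
      rw [cs.simple_mul_simple_cancel_left, cs.length_simple]; omega
    rw [← hm]
    exact (isUnit_T_simple cs φ i).mul (ih _ (by omega))

/-- `T_w` as an invertible element. -/
def TUnit (w : W) : (Hecke cs φ)ˣ := (isUnit_T cs φ w).unit

@[simp] theorem coe_TUnit (w : W) : (TUnit cs φ w : Hecke cs φ) = T cs φ w := rfl

/-- The Hecke algebra as a `ℤ[Γ]`-algebra through `e^γ ↦ e^{-γ}`. -/
@[reducible] def twistedAlgebra : Algebra (GroupRing Γ) (Hecke cs φ) :=
  ((algebraMap (GroupRing Γ) (Hecke cs φ)).comp (barScalar Γ)).toAlgebra'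
    (fun a h => Algebra.commutes (barScalar Γ a) h)

/-- The ring morphism from the free algebra that is `e^γ ↦ e^{-γ}` on scalars and sends the
generator `T_w` to `T_{w⁻¹}⁻¹`. -/
def barFree : FreeAlgebra (GroupRing Γ) W →+* Hecke cs φ :=
  letI := twistedAlgebra cs φ
  (FreeAlgebra.lift (GroupRing Γ)
    (fun w : W => ((TUnit cs φ w⁻¹)⁻¹ : (Hecke cs φ)ˣ).val)).toRingHom

theorem barFree_ι (w : W) : barFree cs φ (FreeAlgebra.ι _ w) =
    ((TUnit cs φ w⁻¹)⁻¹ : (Hecke cs φ)ˣ).val := by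
  let _ := twistedAlgebra cs φ
  exact FreeAlgebra.lift_ι_apply _ _

theorem barFree_algebraMap (a : GroupRing Γ) : barFree cs φ (algebraMap _ _ a) =
    algebraMap (GroupRing Γ) (Hecke cs φ) (barScalar Γ a) :=
  @AlgHom.commutes (GroupRing Γ) _ _ _ _ _ _ (twistedAlgebra cs φ)
    (@FreeAlgebra.lift (GroupRing Γ) W _ (Hecke cs φ) _ (twistedAlgebra cs φ)
      (fun w : W => ((TUnit cs φ w⁻¹)⁻¹ : (Hecke cs φ)ˣ).val)) a

theorem barFree_rel ⦃x y : FreeAlgebra (GroupRing Γ) W⦄ (h : HeckeRel cs φ x y) :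
    barFree cs φ x = barFree cs φ y := by
  cases h with
  | one =>
    rw [barFree_ι, map_one, Units.val_eq_one, inv_eq_one, Units.ext_iff]
    simp [T_one]
  | mul w w' h =>
    rw [map_mul, barFree_ι, barFree_ι, barFree_ι, ← Units.val_mul, ← mul_inv_rev]
    congr 2
    ext
    rw [Units.val_mul, coe_TUnit, coe_TUnit, coe_TUnit, mul_inv_rev]
    apply T_mul
    rw [← mul_inv_rev, cs.length_inv, cs.length_inv, cs.length_inv, h, add_comm]
  | quad i =>
    rw [map_mul, map_sub, map_add, barFree_ι, barFree_algebraMap, barFree_algebraMap, map_zero,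
      barScalar_expo, barScalar_expo, neg_neg, cs.inv_simple]
    have hinv : ((TUnit cs φ (cs.simple i))⁻¹ : (Hecke cs φ)ˣ).val =
        T cs φ (cs.simple i) - E cs φ (φ i) + E cs φ (-φ i) := by
      rw [Units.inv_eq_of_mul_eq_one_right]
      rw [coe_TUnit, mul_add, mul_sub, T_simple_sq, ← E_comm, ← E_comm]; abel
    rw [hinv, ← T_quad cs φ i]
    have h1 : T cs φ (cs.simple i) - E cs φ (φ i) + E cs φ (-φ i) - E cs φ (-φ i) =
      T cs φ (cs.simple i) - E cs φ (φ i) := by abel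
    have h2 : T cs φ (cs.simple i) - E cs φ (φ i) + E cs φ (-φ i) + E cs φ (φ i) =
      T cs φ (cs.simple i) + E cs φ (-φ i) := by abel
    exact congrArg₂ (· * ·) h1 h2

/-- The bar involution of the Hecke algebra: the ring morphism with `e^γ ↦ e^{-γ}` and
`T_w ↦ T_{w⁻¹}⁻¹`. -/
def bar : Hecke cs φ →+* Hecke cs φ :=
  RingQuot.lift ⟨barFree cs φ, barFree_rel cs φ⟩

theorem bar_heckeMk (x : FreeAlgebra (GroupRing Γ) W) :
    bar cs φ (heckeMk cs φ x) = barFree cs φ x := by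
  have h : heckeMk cs φ x = RingQuot.mkRingHom (HeckeRel cs φ) x :=
    congrArg (fun f : _ →+* _ => f x) (RingQuot.mkAlgHom_coe (GroupRing Γ) (HeckeRel cs φ))
  rw [h]
  exact RingQuot.lift_mkRingHom_apply _ _ _

theorem bar_T (w : W) : bar cs φ (T cs φ w) = ((TUnit cs φ w⁻¹)⁻¹ : (Hecke cs φ)ˣ).val := by
  rw [T, bar_heckeMk, barFree_ι]

theorem bar_algebraMap (a : GroupRing Γ) :
    bar cs φ (algebraMap _ _ a) = algebraMap _ _ (barScalar Γ a) := by
  rw [← barFree_algebraMap, ← bar_heckeMk, AlgHom.commutes]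

end Hecke

/-! ### The Kazhdan–Lusztig basis, the left preorder and left cells -/

section Cells

variable {B W : Type*} [Group W] {M : CoxeterMatrix B} (cs : CoxeterSystem M W)
variable {Γ : Type*} [AddCommGroup Γ] [LinearOrder Γ] (φ : B → Γ)

/-- `H_{<0} = ⨁_w ℤ[Γ_{<0}] T_w`. -/
def heckeNeg : AddSubgroup (Hecke cs φ) :=
  AddSubgroup.closure {h | ∃ γ : Γ, γ < 0 ∧ ∃ w : W, h = expo γ • T cs φ w}

/-- `c` is the Kazhdan–Lusztig element attached to `w`: it is fixed by the bar involution and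
congruent to `T_w` modulo `H_{<0}`. -/
def IsKL (w : W) (c : Hecke cs φ) : Prop :=
  bar cs φ c = c ∧ c - T cs φ w ∈ heckeNeg cs φ

open Classical in
/-- The Kazhdan–Lusztig element `C_w`, the unique element with `IsKL cs φ w C_w`. -/
def KL (w : W) : Hecke cs φ :=
  if h : ∃ c, IsKL cs φ w c then h.choose else 0

/-- `x ← y`: for some `h`, the element `C_x` has a non-zero coefficient in the decomposition of
`h C_y` in the basis `(C_z)`. -/
def LeftArrow (x y : W) : Prop :=
  ∃ (h : Hecke cs φ) (a : W →₀ GroupRing Γ),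
    h * KL cs φ y = a.sum (fun z c => c • KL cs φ z) ∧ a x ≠ 0

/-- The left preorder `x ≤_L y`. -/
def LeftLE (x y : W) : Prop := Relation.TransGen (LeftArrow cs φ) x y

/-- `x ∼_L y`. -/
def LeftEquiv (x y : W) : Prop := LeftLE cs φ x y ∧ LeftLE cs φ y x

/-- `C` is a left cell for `(W, S, φ)`. -/
def IsLeftCell (C : Set W) : Prop := ∃ w : W, C = {x | LeftEquiv cs φ x w}

/-- The left ideal `H_{≤ C}`, which is spanned by the `C_w` with `w ≤_L C`. (For a left cell `C`
the `ℤ[Γ]`-span of these elements is already a left ideal, by the definition of `≤_L`.) -/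
def idealLE (C : Set W) : Submodule (Hecke cs φ) (Hecke cs φ) :=
  Submodule.span _ {h | ∃ w : W, (∃ c ∈ C, LeftLE cs φ w c) ∧ h = KL cs φ w}

/-- The left ideal `H_{< C}`, which is spanned by the `C_w` with `w ≤_L C` and `w ∉ C`. (For a left
cell `C` the `ℤ[Γ]`-span of these elements is already a left ideal, by the definition of `≤_L`.) -/
def idealLT (C : Set W) : Submodule (Hecke cs φ) (Hecke cs φ) :=
  Submodule.span _ {h | ∃ w : W, ((∃ c ∈ C, LeftLE cs φ w c) ∧ w ∉ C) ∧ h = KL cs φ w}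

/-- The left `H`-module `M_C = H_{≤ C} / H_{< C}`. -/
abbrev CellModule (C : Set W) : Type _ :=
  idealLE cs φ C ⧸ (idealLT cs φ C).submoduleOf (idealLE cs φ C)

end Cells

/-! ### Specialisation at `e^γ ↦ 1` -/

section Specialisation

variable {B W : Type*} [Group W] {M : CoxeterMatrix B} (cs : CoxeterSystem M W)
variable {Γ : Type*} [AddCommGroup Γ] (φ : B → Γ)
variable (V : Type*) [AddCommGroup V] [Module (GroupRing Γ) V] [Module (Hecke cs φ) V]
  [IsScalarTower (GroupRing Γ) (Hecke cs φ) V]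

/-- Multiplication by `h ∈ H` on `ℤ ⊗_{ℤ[Γ]} V`. -/
def specAct (h : Hecke cs φ) : Module.End ℤ (AugInt Γ ⊗[GroupRing Γ] V) :=
  (LinearMap.lTensor (AugInt Γ)
    (Algebra.lsmul (GroupRing Γ) (GroupRing Γ) V h)).toAddMonoidHom.toIntLinearMap

@[simp] theorem specAct_tmul (h : Hecke cs φ) (n : AugInt Γ) (v : V) :
    specAct cs φ V h (n ⊗ₜ v) = n ⊗ₜ (h • v) := rfl

variable {V} in
theorem specEnd_ext {f g : Module.End ℤ (AugInt Γ ⊗[GroupRing Γ] V)}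
    (h : ∀ n v, f (n ⊗ₜ v) = g (n ⊗ₜ v)) : f = g := by
  ext x
  induction x with
  | zero => simp
  | tmul n v => exact h n v
  | add x y hx hy => rw [map_add, map_add, hx, hy]

theorem specAct_one : specAct cs φ V 1 = 1 := specEnd_ext (by simp)

theorem specAct_mul (h h' : Hecke cs φ) :
    specAct cs φ V (h * h') = specAct cs φ V h * specAct cs φ V h' :=
  specEnd_ext (by simp [mul_smul])

theorem specAct_simple_sq (i : B) :
    specAct cs φ V (T cs φ (cs.simple i)) * specAct cs φ V (T cs φ (cs.simple i)) = 1 := by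
  rw [← specAct_mul, T_simple_sq]
  refine specEnd_ext fun n v => ?_
  rw [specAct_tmul, sub_smul, add_smul, TensorProduct.tmul_sub, TensorProduct.tmul_add, one_smul,
    mul_smul, mul_smul, algebraMap_smul, algebraMap_smul, ← TensorProduct.smul_tmul (expo (φ i)),
    ← TensorProduct.smul_tmul (expo (-φ i)), expo_smul_augInt, expo_smul_augInt]
  simp

theorem specAct_simple_mul (i : B) (w : W) :
    specAct cs φ V (T cs φ (cs.simple i * w)) =
      specAct cs φ V (T cs φ (cs.simple i)) * specAct cs φ V (T cs φ w) := by
  rcases cs.length_simple_mul w i with h | h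
  · rw [← specAct_mul, T_mul]
    rw [h, cs.length_simple, add_comm]
  · have : T cs φ w = T cs φ (cs.simple i) * T cs φ (cs.simple i * w) := by
      rw [T_mul, cs.simple_mul_simple_cancel_left]
      rw [cs.simple_mul_simple_cancel_left, cs.length_simple]; omega
    rw [this, specAct_mul, ← mul_assoc, specAct_simple_sq, one_mul]

theorem specAct_T_mul (w w' : W) : specAct cs φ V (T cs φ (w * w')) =
    specAct cs φ V (T cs φ w) * specAct cs φ V (T cs φ w') := by
  induction w using cs.simple_induction_left with
  | one => rw [one_mul, T_one, specAct_one, one_mul]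
  | mul_simple_left w i ih => rw [mul_assoc, specAct_simple_mul, ih, specAct_simple_mul, mul_assoc]

/-- The `ℤW`-module `ℤ ⊗_{ℤ[Γ]} V` of an `H`-module `V`; the identification of
`ℤ ⊗_{ℤ[Γ]} H` with `ℤW` sends `1 ⊗ T_w` to `w`, so `w ∈ W` acts as `T_w`. -/
def specRep : Representation ℤ W (AugInt Γ ⊗[GroupRing Γ] V) where
  toFun w := specAct cs φ V (T cs φ w)
  map_one' := by rw [T_one, specAct_one]
  map_mul' := specAct_T_mul cs φ V

end Specialisation

section CellRep

variable {B W : Type*} [Group W] {M : CoxeterMatrix B} (cs : CoxeterSystem M W)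
variable {Γ : Type*} [AddCommGroup Γ] [LinearOrder Γ] (φ : B → Γ)

/-- The `ℤW`-module `ℤ M_C = ℤ ⊗_{ℤ[Γ]} M_C` of a left cell `C`. -/
def cellRep (C : Set W) : Representation ℤ W (AugInt Γ ⊗[GroupRing Γ] CellModule cs φ C) :=
  specRep cs φ (CellModule cs φ C)

end CellRep

/-! ### Zero values of the parameter -/

section Zero

variable {B W : Type*} [Group W] {M : CoxeterMatrix B} (cs : CoxeterSystem M W) (I : Set B)

/-- The parabolic subgroup `W_I`. -/
def parabolic : Subgroup W := Subgroup.closure (cs.simple '' I)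

/-- `J̃ = {w t w⁻¹ | w ∈ W_I, t ∈ J}`, where `J` is the complement of `I`. -/
def tildeJ : Set W :=
  {t | ∃ j : B, j ∉ I ∧ ∃ w ∈ parabolic cs I, t = w * cs.simple j * w⁻¹}

/-- `W̃`, the subgroup generated by `J̃`. -/
def tildeW : Subgroup W := Subgroup.closure (tildeJ cs I)

theorem tildeJ_mem (t : tildeJ cs I) :
    ∃ j : B, j ∉ I ∧ ∃ w ∈ parabolic cs I, (t : W) = w * cs.simple j * w⁻¹ := t.2

variable {Γ : Type*} (φ : B → Γ)

/-- `φ̃ : J̃ → Γ`, `φ̃(t̃) = φ(t)` where `t ∈ J` is `W_I`-conjugate to `t̃`. -/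
def tildePhi (t : tildeJ cs I) : Γ := φ (tildeJ_mem cs I t).choose

/-- `φ̃` does not depend on the choice made. -/
theorem tildePhi_eq (hφ : IsParameter cs φ) (t : tildeJ cs I) (j : B) (w : W)
    (ht : (t : W) = w * cs.simple j * w⁻¹) : tildePhi cs I φ t = φ j := by
  obtain ⟨-, v, -, hv⟩ := (tildeJ_mem cs I t).choose_spec
  refine hφ _ _ (isConj_iff.2 ⟨w⁻¹ * v, ?_⟩)
  have h2 := hv.symm.trans ht
  generalize (tildeJ_mem cs I t).choose = k at h2 ⊢
  calc w⁻¹ * v * cs.simple k * (w⁻¹ * v)⁻¹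
      = w⁻¹ * (v * cs.simple k * v⁻¹) * w := by group
    _ = cs.simple j := by rw [h2]; group

end Zero

end KLCells

end

/-! Write elements of `W` as `a x` with `a ∈ W_I` and `x ∈ W̃`. Everything follows from the formula
`C_{ax} = T_a C_x` (`KL_mul`).

Group side. An odd braid relation would conjugate its two generators, so `m(i,j)` is even or
infinite for `i ∈ I`, `j ∉ I`. Let `G` be the abstract Coxeter group on `J̃` whose matrix records
the orders of the products `t t'` in `W`. A mixed relation of exponent `2k` becomes `((s_i s_j s_i)
s_j)^k = 1`, a relation between two elements of `J̃`, so `W` maps to `G ⋊ W_I`. This map inverts `G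
→ W̃`; hence `(W̃, J̃)` is a Coxeter system and `W = W̃ ⋊ W_I`.

Hecke side. As `φ = 0` on `I`, the quadratic relation there reads `T_s² = 1`. Hence `T_a T_w =
T_{aw}` and `T_w T_a = T_{wa}` for `a ∈ W_I`, whatever the lengths, and `T_a` is fixed by the bar
involution. The length on `W̃` is the least number of letters outside `I` in a word; with the
exchange condition (`isLeftDescent_tilde`) this shows that products in `W̃` with additive lengths
also multiply well in `H(W)` (`T_tildeW_mul`). So `T_x ↦ T_x` embeds `H(W̃)` in `H(W)` compatibly
with the bar involutions, and `H(W)` is the direct sum of the `T_a H(W̃)`. Uniqueness of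
Kazhdan–Lusztig elements then gives `KL_mul`.

Cells. By `KL_mul`, `b x' ← a x` holds in `W` exactly when `x' ← x` holds in `W̃`
(`leftArrow_mul_iff`), so `W_I C` is a left cell. After specialisation `a · (1 ⊗ C_x) = 1 ⊗ C_{ax}`,
and `W_I` represents the cosets of `W̃`: this is an induced module (`equivInd`).

The Hecke algebra is given by a presentation only, so its basis `(T_w)` and the existence and
uniqueness of `C_w` are also established (`TBasis`, `exists_isKL`, `IsKL.unique`). -/

namespace KLCells

/-! ### The exchange condition for arbitrary words -/

section Exchange

variable {B W : Type*} [Group W] {M : CoxeterMatrix B} (cs : CoxeterSystem M W)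

theorem end_mul_apply {α : Type*} (f g : Function.End α) (x : α) : (f * g) x = f (g x) := rfl

theorem end_one_apply {α : Type*} (x : α) : (1 : Function.End α) x = x := rfl

open Classical in
/-- The action of a simple reflection `s` on `W × ℤ/2`: conjugation by `s` on the first component,
and a change of sign at `s`. -/
noncomputable def signedConj (i : B) : Function.End (W × ZMod 2) := fun p =>
  (cs.simple i * p.1 * cs.simple i, p.2 + if p.1 = cs.simple i then 1 else 0)

open Classical in
-- The sign flips each time the point conjugated so far meets the next letter; pulled back to `t`,
-- these are the `2m` reflections `r⁻ᵏ s_j` of the alternating word, with `r = s_i s_j`.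
theorem signedConj_pow (i j : B) (m : ℕ) (t : W) (ε : ZMod 2) :
    ((signedConj cs i * signedConj cs j) ^ m) (t, ε) =
      ((cs.simple i * cs.simple j) ^ m * t * ((cs.simple i * cs.simple j) ^ m)⁻¹,
        ε + ∑ k ∈ Finset.range (2 * m),
          if t = ((cs.simple i * cs.simple j)⁻¹) ^ k * cs.simple j then 1 else 0) := by
  induction m with
  | zero => simp [end_one_apply]
  | succ m ih =>
    set r := cs.simple i * cs.simple j with hr
    have hr' : r⁻¹ = cs.simple j * cs.simple i := by simp [hr]
    have hc : cs.simple j * r⁻¹ = r * cs.simple j := by rw [hr']; simp [hr, ← mul_assoc]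
    have hcm : ∀ k : ℕ, cs.simple j * (r⁻¹) ^ k = r ^ k * cs.simple j := by
      intro k
      induction k with
      | zero => simp
      | succ k ihk => rw [pow_succ, ← mul_assoc, ihk, mul_assoc, hc, ← mul_assoc, ← pow_succ]
    have hcm' : ∀ k : ℕ, cs.simple j * r ^ k = (r⁻¹) ^ k * cs.simple j := by
      intro k
      have := congrArg (fun x => cs.simple j * x * cs.simple j) (hcm k)
      simpa [mul_assoc] using this.symm
    rw [pow_succ', end_mul_apply, ih, end_mul_apply]
    simp only [signedConj]
    have h1 : (r ^ m * t * (r ^ m)⁻¹ = cs.simple j) ↔ t = (r⁻¹) ^ (2 * m) * cs.simple j := by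
      rw [mul_inv_eq_iff_eq_mul, ← eq_inv_mul_iff_mul_eq, hcm', two_mul, pow_add, ← inv_pow,
        mul_assoc]
    have h2 : (cs.simple j * (r ^ m * t * (r ^ m)⁻¹) * cs.simple j = cs.simple i) ↔
        t = (r⁻¹) ^ (2 * m + 1) * cs.simple j := by
      have : (cs.simple j * (r ^ m * t * (r ^ m)⁻¹) * cs.simple j = cs.simple i) ↔
          r ^ m * t * (r ^ m)⁻¹ = r⁻¹ * cs.simple j := by
        rw [hr']
        constructor
        · intro h; rw [← h]; simp [mul_assoc]
        · intro h; rw [h]; simp [mul_assoc]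
      rw [this, mul_inv_eq_iff_eq_mul, ← eq_inv_mul_iff_mul_eq, mul_assoc, hcm', ← inv_pow,
        ← mul_assoc, ← mul_assoc, ← pow_succ, ← pow_add, show m + 1 + m = 2 * m + 1 by ring]
    rw [Prod.mk.injEq]
    constructor
    · rw [pow_succ' r, mul_inv_rev, hr']
      simp only [hr, mul_assoc]
    · rw [show 2 * (m + 1) = 2 * m + 1 + 1 by ring, Finset.sum_range_succ, Finset.sum_range_succ]
      simp only [h1, h2, add_assoc]

/-- For `m = M i j` the reflections `r⁻ᵏ s_j` are periodic in `k` with period `m`, so the `2m` sign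
changes cancel in pairs modulo 2. -/
theorem signedConj_isLiftable : M.IsLiftable (signedConj cs) := by
  classical
  intro i j
  funext ⟨t, ε⟩
  have h := cs.simple_mul_simple_pow i j
  have h' : ((cs.simple i * cs.simple j)⁻¹) ^ M i j = 1 := by rw [inv_pow, h, inv_one]
  rw [signedConj_pow, h, two_mul, Finset.sum_range_add]
  simp only [pow_add, h', one_mul, inv_one, mul_one, CharTwo.add_self_eq_zero, add_zero]
  rfl

/-- The action of `W` on `W × ℤ/2`. -/
noncomputable def signedConjHom : W →* Function.End (W × ZMod 2) :=
  cs.lift ⟨signedConj cs, signedConj_isLiftable cs⟩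

open Classical in
-- The left side involves only the product of the word. Hence so does the parity of the number of
-- occurrences of `t` in the inversion sequence, reduced word or not.
theorem signedConjHom_wordProd_inv (ω : List B) (t : W) (ε : ZMod 2) :
    (signedConjHom cs (cs.wordProd ω)⁻¹ (t, ε)).2 = ε + ((cs.leftInvSeq ω).count t : ℕ) := by
  induction ω generalizing t ε with
  | nil => simp [end_one_apply]
  | cons i ω ih =>
    rw [cs.wordProd_cons, mul_inv_rev, map_mul, end_mul_apply,
      cs.inv_simple, signedConjHom, cs.lift_apply_simple, signedConj, ← signedConjHom, ih]
    rw [CoxeterSystem.leftInvSeq, List.count_cons]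
    have : (cs.leftInvSeq ω).count (cs.simple i * t * cs.simple i) =
        ((cs.leftInvSeq ω).map (MulAut.conj (cs.simple i))).count t := by
      rw [← List.count_map_of_injective _ _ (MulAut.conj (cs.simple i)).injective]
      simp [mul_assoc]
    rw [this]
    simp only [beq_iff_eq, eq_comm (a := t)]
    push_cast
    ring

/-- The exchange condition, for a word that need not be reduced. -/
theorem simple_mem_leftInvSeq {i : B} {ω : List B}
    (h : cs.IsLeftDescent (cs.wordProd ω) i) : cs.simple i ∈ cs.leftInvSeq ω := by
  classical
  -- The comparison word `i :: ω'` is reduced with the same product, so `s_i` occurs exactly once in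
  -- its inversion sequence; by parity it occurs in that of `ω`.
  obtain ⟨ω', hω', hw⟩ := cs.exists_isReduced (cs.simple i * cs.wordProd ω)
  have hw' : cs.wordProd (i :: ω') = cs.wordProd ω := by
    rw [cs.wordProd_cons, ← hw, cs.simple_mul_simple_cancel_left]
  have hred : cs.IsReduced (i :: ω') := by
    have h1 := cs.isLeftDescent_iff.1 h
    rw [CoxeterSystem.IsReduced, hw', List.length_cons, ← hω'.eq, ← hw, h1]
  have h1 := signedConjHom_wordProd_inv cs (i :: ω') (cs.simple i) 0
  rw [hw', signedConjHom_wordProd_inv, List.count_eq_one_of_mem hred.nodup_leftInvSeq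
    (by simp [CoxeterSystem.leftInvSeq])] at h1
  by_contra hn
  rw [List.count_eq_zero_of_not_mem hn] at h1
  simp at h1

theorem exists_exchange {i : B} {ω : List B} (h : cs.IsLeftDescent (cs.wordProd ω) i) :
    ∃ (ω₁ : List B) (k : B) (ω₂ : List B), ω = ω₁ ++ k :: ω₂ ∧
      cs.simple i = cs.wordProd ω₁ * cs.simple k * (cs.wordProd ω₁)⁻¹ ∧
      cs.simple i * cs.wordProd ω = cs.wordProd (ω₁ ++ ω₂) := by
  obtain ⟨n, hn, hi⟩ := List.mem_iff_getElem.1 (simple_mem_leftInvSeq cs h)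
  rw [cs.length_leftInvSeq] at hn
  rw [cs.getElem_leftInvSeq ω n hn] at hi
  have hω : ω = ω.take n ++ ω[n] :: ω.drop (n + 1) := by simp
  refine ⟨ω.take n, ω[n], ω.drop (n + 1), hω, hi.symm, ?_⟩
  conv_lhs => rw [hω]
  rw [← hi, cs.wordProd_append, cs.wordProd_cons, cs.wordProd_append]
  simp [mul_assoc]

/-- Apply exchange to a reduced word of `w` followed by `j`: the letter deleted must be the final
`j`. -/
theorem simple_mul_eq_mul_simple {w : W} {i j : B} (hi : ¬ cs.IsLeftDescent w i)
    (hi' : cs.IsLeftDescent (w * cs.simple j) i) : cs.simple i * w = w * cs.simple j := by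
  obtain ⟨ω, hω, rfl⟩ := cs.exists_isReduced w
  have h : cs.IsLeftDescent (cs.wordProd (ω ++ [j])) i := by
    rwa [cs.wordProd_append, cs.wordProd_singleton]
  obtain ⟨ω₁, k, ω₂, hk, -, he⟩ := exists_exchange cs h
  rw [cs.wordProd_append, cs.wordProd_singleton, ← mul_assoc] at he
  -- If `ω₂` is nonempty, the deleted letter lies inside `ω`, and cancelling `s_j` on the right
  -- makes `s_i w` shorter than `w`, against `hi`.
  rcases List.eq_nil_or_concat ω₂ with rfl | ⟨ω₃, l, rfl⟩
  · obtain ⟨h1, h2⟩ := List.append_inj' hk rfl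
    subst h1
    rw [List.append_nil] at he
    conv_rhs => rw [← he]
    simp
  · exfalso
    rw [List.concat_eq_append, ← List.cons_append, ← List.append_assoc] at hk
    obtain ⟨h1, h2⟩ := List.append_inj' hk rfl
    obtain rfl : j = l := by simpa using h2
    rw [List.concat_eq_append, ← List.append_assoc, cs.wordProd_append, cs.wordProd_singleton,
      mul_left_inj] at he
    apply hi
    have h4 := cs.length_wordProd_le (ω₁ ++ ω₃)
    rw [CoxeterSystem.IsLeftDescent, he, hω.eq, h1]
    simp only [List.length_append, List.length_cons] at h4 ⊢
    omega

end Exchange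

end KLCells

namespace KLCells

/-! ### The basis `(T_w)` of the Hecke algebra -/

section Free

variable {B W : Type*} [Group W] {M : CoxeterMatrix B} (cs : CoxeterSystem M W)
variable {Γ : Type*} [AddCommGroup Γ] (φ : B → Γ)

theorem isLeftDescent_mul_simple_iff (w : W) {i j : B} (h : cs.simple i * w ≠ w * cs.simple j) :
    cs.IsLeftDescent (w * cs.simple j) i ↔ cs.IsLeftDescent w i := by
  constructor
  · intro h1
    by_contra h2
    exact h (simple_mul_eq_mul_simple cs h2 h1)
  · intro h1
    by_contra h2
    have := simple_mul_eq_mul_simple cs (w := w * cs.simple j) (i := i) (j := j) h2 (by simpa)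
    rw [cs.simple_mul_simple_cancel_right] at this
    apply h
    calc cs.simple i * w = cs.simple i * (w * cs.simple j) * cs.simple j := by simp [mul_assoc]
      _ = w * cs.simple j := by rw [this]

theorem isRightDescent_simple_mul_iff (w : W) {i j : B} (h : cs.simple i * w ≠ w * cs.simple j) :
    cs.IsRightDescent (cs.simple i * w) j ↔ cs.IsRightDescent w j := by
  rw [← cs.isLeftDescent_inv_iff, mul_inv_rev, cs.inv_simple, isLeftDescent_mul_simple_iff,
    cs.isLeftDescent_inv_iff]
  intro h1
  apply h
  simpa using congrArg (·⁻¹) h1.symm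

/-- The coefficient `e^{φ(s)} - e^{-φ(s)}`. -/
noncomputable def heckeCoeff (i : B) : GroupRing Γ := expo (φ i) - expo (-φ i)

open Classical in
/-- Left multiplication by `T_s` on the free module with basis `W`. -/
noncomputable def leftOp (i : B) : Module.End (GroupRing Γ) (W →₀ GroupRing Γ) :=
  Finsupp.linearCombination (GroupRing Γ) fun w =>
    Finsupp.single (cs.simple i * w) 1 +
      (if cs.IsLeftDescent w i then heckeCoeff φ i else 0) • Finsupp.single w 1

open Classical in
/-- Right multiplication by `T_s` on the free module with basis `W`. -/
noncomputable def rightOp (i : B) : Module.End (GroupRing Γ) (W →₀ GroupRing Γ) :=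
  Finsupp.linearCombination (GroupRing Γ) fun w =>
    Finsupp.single (w * cs.simple i) 1 +
      (if cs.IsRightDescent w i then heckeCoeff φ i else 0) • Finsupp.single w 1

open Classical in
theorem leftOp_single (i : B) (w : W) : leftOp cs φ i (Finsupp.single w 1) =
    Finsupp.single (cs.simple i * w) 1 +
      (if cs.IsLeftDescent w i then heckeCoeff φ i else 0) • Finsupp.single w 1 := by
  rw [leftOp, Finsupp.linearCombination_single, one_smul]

open Classical in
theorem rightOp_single (i : B) (w : W) : rightOp cs φ i (Finsupp.single w 1) =
    Finsupp.single (w * cs.simple i) 1 +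
      (if cs.IsRightDescent w i then heckeCoeff φ i else 0) • Finsupp.single w 1 := by
  rw [rightOp, Finsupp.linearCombination_single, one_smul]

theorem finsupp_end_ext {R α N : Type*} [CommRing R] [AddCommGroup N] [Module R N]
    {f g : (α →₀ R) →ₗ[R] N}
    (h : ∀ a, f (Finsupp.single a 1) = g (Finsupp.single a 1)) : f = g := by
  ext a
  exact h a

variable {φ}

/-- Either `s_i w = w s_j`, so that `s_i` and `s_j` are conjugate and their coefficients agree, or
neither multiplication affects the descent seen by the other. This is where constancy of `φ` on
conjugate generators is needed. -/
theorem leftOp_comm_rightOp (hφ : IsParameter cs φ) (i j : B) :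
    Commute (leftOp cs φ i) (rightOp cs φ j) := by
  classical
  refine finsupp_end_ext fun w => ?_
  rw [Module.End.mul_apply, Module.End.mul_apply, rightOp_single, leftOp_single, map_add, map_add,
    map_smul, map_smul, leftOp_single, leftOp_single, rightOp_single, rightOp_single, mul_assoc]
  by_cases h : cs.simple i * w = w * cs.simple j
  · have hij : heckeCoeff φ i = heckeCoeff φ j := by
      rw [heckeCoeff, heckeCoeff, hφ i j]
      rw [isConj_comm, isConj_iff]
      exact ⟨w, by rw [← h]; simp⟩
    have h1 : cs.IsLeftDescent w i ↔ cs.IsRightDescent w j := by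
      rw [CoxeterSystem.IsLeftDescent, CoxeterSystem.IsRightDescent, h]
    have h2 : cs.IsLeftDescent (w * cs.simple j) i ↔ cs.IsRightDescent (w * cs.simple j) j := by
      rw [← h, CoxeterSystem.IsLeftDescent, CoxeterSystem.IsRightDescent, h]
      rw [cs.simple_mul_simple_cancel_right, ← h, cs.simple_mul_simple_cancel_left]
    simp only [h, hij, h1, h2]
  · simp only [isLeftDescent_mul_simple_iff cs w h, isRightDescent_simple_mul_iff cs w h,
      smul_add, smul_smul]
    rw [mul_comm (if cs.IsRightDescent w j then _ else _)]
    abel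

theorem leftOp_sq (i : B) : leftOp cs φ i * leftOp cs φ i = 1 + heckeCoeff φ i • leftOp cs φ i := by
  classical
  refine finsupp_end_ext fun w => ?_
  rw [Module.End.mul_apply, leftOp_single, map_add, map_smul, leftOp_single, LinearMap.add_apply,
    LinearMap.smul_apply, leftOp_single, cs.simple_mul_simple_cancel_left, Module.End.one_apply]
  by_cases h : cs.IsLeftDescent w i
  · have := cs.isLeftDescent_iff_not_isLeftDescent_mul.1 h
    simp [h, this]
  · have : cs.IsLeftDescent (cs.simple i * w) i := by
      by_contra h'
      exact h (cs.isLeftDescent_iff_not_isLeftDescent_mul.2 h')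
    simp [h, this]

theorem end_quad {R N : Type*} [CommRing R] [AddCommGroup N] [Module R N] {f : Module.End R N}
    {a b : R} (h : f * f = 1 + (a - b) • f) (hab : a * b = 1) :
    (f - algebraMap R _ a) * (f + algebraMap R _ b) = 0 := by
  rw [sub_mul, mul_add, h, mul_add, ← map_mul, hab, map_one, ← Algebra.commutes, sub_smul,
    Algebra.smul_def, Algebra.smul_def]
  abel

theorem leftOp_quad (i : B) :
    (leftOp cs φ i - algebraMap (GroupRing Γ) _ (expo (φ i))) *
      (leftOp cs φ i + algebraMap (GroupRing Γ) _ (expo (-φ i))) = 0 :=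
  end_quad (leftOp_sq cs i) (by rw [expo_mul, add_neg_cancel, expo_zero])

/-- The product of the operators `leftOp` along a word. -/
noncomputable def leftOpWord (φ : B → Γ) (ω : List B) :
    Module.End (GroupRing Γ) (W →₀ GroupRing Γ) :=
  (ω.map (leftOp cs φ)).prod

theorem leftOpWord_single_one {ω : List B} (hω : cs.IsReduced ω) :
    leftOpWord cs φ ω (Finsupp.single 1 1) = Finsupp.single (cs.wordProd ω) 1 := by
  classical
  induction ω with
  | nil => simp [leftOpWord]
  | cons i ω ih =>
    have hω' : cs.IsReduced ω := by simpa using hω.drop 1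
    have hd : ¬ cs.IsLeftDescent (cs.wordProd ω) i := by
      rw [CoxeterSystem.IsLeftDescent, ← cs.wordProd_cons, hω.eq, hω'.eq]
      simp
    have := ih hω'
    rw [leftOpWord] at this ⊢
    rw [List.map_cons, List.prod_cons, Module.End.mul_apply, this, leftOp_single, if_neg hd,
      zero_smul, add_zero, cs.wordProd_cons]

theorem leftOpWord_comm_rightOp (hφ : IsParameter cs φ) (ω : List B) (j : B) :
    Commute (leftOpWord cs φ ω) (rightOp cs φ j) := by
  induction ω with
  | nil => simp [leftOpWord]
  | cons i ω ih => exact (leftOp_comm_rightOp cs hφ i j).mul_left ih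

/-- Every basis vector is obtained from that of `1` by right operators. This makes `leftOpWord` the
same for all reduced words of an element, with no appeal to braid moves. -/
theorem end_ext_of_commute {f g : Module.End (GroupRing Γ) (W →₀ GroupRing Γ)}
    (hf : ∀ j, Commute f (rightOp cs φ j)) (hg : ∀ j, Commute g (rightOp cs φ j))
    (h : f (Finsupp.single 1 1) = g (Finsupp.single 1 1)) : f = g := by
  classical
  refine finsupp_end_ext fun w => ?_
  induction hn : cs.length w generalizing w with
  | zero => rwa [cs.length_eq_zero_iff.1 hn]
  | succ n ih =>
    have hw : w ≠ 1 := by rintro rfl; simp at hn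
    obtain ⟨j, hj⟩ := cs.exists_rightDescent_of_ne_one hw
    have h1 := cs.isRightDescent_iff.1 hj
    have h2 : rightOp cs φ j (Finsupp.single (w * cs.simple j) 1) = Finsupp.single w 1 := by
      rw [rightOp_single, if_neg (cs.isRightDescent_iff_not_isRightDescent_mul.1 hj), zero_smul,
        add_zero, cs.simple_mul_simple_cancel_right]
    rw [← h2, ← Module.End.mul_apply, ← Module.End.mul_apply, (hf j).eq, (hg j).eq,
      Module.End.mul_apply, Module.End.mul_apply, ih _ (by omega)]

/-- The operator attached to `w`, through a reduced word. -/
noncomputable def leftOpElem (φ : B → Γ) (w : W) : Module.End (GroupRing Γ) (W →₀ GroupRing Γ) :=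
  leftOpWord cs φ (cs.exists_isReduced w).choose

theorem leftOpElem_single_one (w : W) :
    leftOpElem cs φ w (Finsupp.single 1 1) = Finsupp.single w 1 := by
  obtain ⟨h1, h2⟩ := (cs.exists_isReduced w).choose_spec
  rw [leftOpElem, leftOpWord_single_one cs h1, ← h2]

theorem leftOpElem_wordProd (hφ : IsParameter cs φ) {ω : List B} (hω : cs.IsReduced ω) :
    leftOpElem cs φ (cs.wordProd ω) = leftOpWord cs φ ω :=
  end_ext_of_commute cs (leftOpWord_comm_rightOp cs hφ _) (leftOpWord_comm_rightOp cs hφ _)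
    (by rw [leftOpElem_single_one, leftOpWord_single_one cs hω])

theorem leftOpElem_simple (hφ : IsParameter cs φ) (i : B) :
    leftOpElem cs φ (cs.simple i) = leftOp cs φ i := by
  have h : cs.IsReduced [i] := by simp [CoxeterSystem.IsReduced]
  simpa [leftOpWord] using leftOpElem_wordProd cs hφ h

theorem leftOpElem_mul (hφ : IsParameter cs φ) (w w' : W)
    (h : cs.length (w * w') = cs.length w + cs.length w') :
    leftOpElem cs φ w * leftOpElem cs φ w' = leftOpElem cs φ (w * w') := by
  obtain ⟨ω, hω, rfl⟩ := cs.exists_isReduced w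
  obtain ⟨ω', hω', rfl⟩ := cs.exists_isReduced w'
  have hred : cs.IsReduced (ω ++ ω') := by
    rw [CoxeterSystem.IsReduced, cs.wordProd_append, h, hω.eq, hω'.eq, List.length_append]
  rw [← cs.wordProd_append, leftOpElem_wordProd cs hφ hω, leftOpElem_wordProd cs hφ hω',
    leftOpElem_wordProd cs hφ hred, leftOpWord, leftOpWord, leftOpWord, List.map_append,
    List.prod_append]

/-- The regular representation of the Hecke algebra on the free module with basis `W`. -/
noncomputable def regularRep (hφ : IsParameter cs φ) :
    Hecke cs φ →ₐ[GroupRing Γ] Module.End (GroupRing Γ) (W →₀ GroupRing Γ) :=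
  RingQuot.liftAlgHom (GroupRing Γ) ⟨FreeAlgebra.lift (GroupRing Γ) (leftOpElem cs φ), by
    intro x y h
    cases h with
    | one =>
      have h : cs.IsReduced [] := by simp [CoxeterSystem.IsReduced]
      have := leftOpElem_wordProd cs hφ h
      rw [FreeAlgebra.lift_ι_apply, map_one]
      simpa [leftOpWord] using this
    | mul w w' h =>
      rw [map_mul, FreeAlgebra.lift_ι_apply, FreeAlgebra.lift_ι_apply, FreeAlgebra.lift_ι_apply,
        leftOpElem_mul cs hφ w w' h]
    | quad i =>
      rw [map_mul, map_sub, map_add, FreeAlgebra.lift_ι_apply, leftOpElem_simple cs hφ,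
        AlgHom.commutes, AlgHom.commutes, map_zero]
      exact leftOp_quad cs i⟩

theorem regularRep_T (hφ : IsParameter cs φ) (w : W) :
    regularRep cs hφ (T cs φ w) = leftOpElem cs φ w := by
  rw [T, heckeMk, regularRep]
  erw [RingQuot.liftAlgHom_mkAlgHom_apply]
  rw [FreeAlgebra.lift_ι_apply]

/-- Evaluating the regular representation at the basis vector of `1` sends `T_w` to the basis vector
of `w`. -/
theorem linearIndependent_T (hφ : IsParameter cs φ) :
    LinearIndependent (GroupRing Γ) (T cs φ) := by
  have h : LinearIndependent (GroupRing Γ)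
      (((LinearMap.applyₗ (Finsupp.single (1 : W) (1 : GroupRing Γ))).comp
        (regularRep cs hφ).toLinearMap) ∘ T cs φ) := by
    have : (((LinearMap.applyₗ (Finsupp.single (1 : W) (1 : GroupRing Γ))).comp
        (regularRep cs hφ).toLinearMap) ∘ T cs φ) = fun w => Finsupp.single w 1 := by
      funext w
      simp [regularRep_T, leftOpElem_single_one]
    rw [this]
    exact Finsupp.linearIndependent_single_one _ _
  exact h.of_comp _

variable (φ)

theorem T_simple_mul_of_not_descent (i : B) (w : W) (h : ¬ cs.IsLeftDescent w i) :
    T cs φ (cs.simple i) * T cs φ w = T cs φ (cs.simple i * w) := by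
  rw [T_mul]
  rw [cs.not_isLeftDescent_iff.1 h, cs.length_simple, add_comm]

theorem T_simple_sq' (i : B) : T cs φ (cs.simple i) * T cs φ (cs.simple i) =
    1 + heckeCoeff φ i • T cs φ (cs.simple i) := by
  rw [T_simple_sq, heckeCoeff, sub_smul, Algebra.smul_def, Algebra.smul_def]
  abel

theorem T_simple_mul_of_descent (i : B) (w : W) (h : cs.IsLeftDescent w i) :
    T cs φ (cs.simple i) * T cs φ w =
      T cs φ (cs.simple i * w) + heckeCoeff φ i • T cs φ w := by
  have h1 := T_simple_mul_of_not_descent cs φ i _ (cs.isLeftDescent_iff_not_isLeftDescent_mul.1 h)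
  rw [cs.simple_mul_simple_cancel_left] at h1
  conv_lhs => rw [← h1, ← mul_assoc, T_simple_sq', add_mul, one_mul, smul_mul_assoc, h1]

theorem T_mul_mem_span (w : W) (h : Hecke cs φ)
    (hh : h ∈ Submodule.span (GroupRing Γ) (Set.range (T cs φ))) :
    T cs φ w * h ∈ Submodule.span (GroupRing Γ) (Set.range (T cs φ)) := by
  induction hn : cs.length w generalizing w h with
  | zero => rwa [cs.length_eq_zero_iff.1 hn, T_one, one_mul]
  | succ n ih =>
    have hw : w ≠ 1 := by rintro rfl; simp at hn
    obtain ⟨i, hi⟩ := cs.exists_leftDescent_of_ne_one hw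
    have hi' := cs.isLeftDescent_iff.1 hi
    have h1 := T_simple_mul_of_not_descent cs φ i _
      (cs.isLeftDescent_iff_not_isLeftDescent_mul.1 hi)
    rw [cs.simple_mul_simple_cancel_left] at h1
    rw [← h1, mul_assoc]
    have h2 := ih (cs.simple i * w) h hh (by omega)
    generalize T cs φ (cs.simple i * w) * h = y at h2
    induction h2 using Submodule.span_induction with
    | mem x hx =>
      obtain ⟨y, rfl⟩ := hx
      by_cases hd : cs.IsLeftDescent y i
      · rw [T_simple_mul_of_descent cs φ i y hd]
        exact add_mem (Submodule.subset_span ⟨_, rfl⟩)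
          (Submodule.smul_mem _ _ (Submodule.subset_span ⟨_, rfl⟩))
      · rw [T_simple_mul_of_not_descent cs φ i y hd]
        exact Submodule.subset_span ⟨_, rfl⟩
    | zero => simp
    | add x y _ _ hx hy => rw [mul_add]; exact add_mem hx hy
    | smul a x _ hx => rw [mul_smul_comm]; exact Submodule.smul_mem _ _ hx

theorem heckeMk_surjective : Function.Surjective (heckeMk cs φ) :=
  RingQuot.mkAlgHom_surjective _ _

/-- The span contains `1` and is stable under left multiplication by every generator of the algebra.
-/
theorem span_T : Submodule.span (GroupRing Γ) (Set.range (T cs φ)) = ⊤ := by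
  rw [eq_top_iff]
  have key : ∀ x : FreeAlgebra (GroupRing Γ) W,
      ∀ h ∈ Submodule.span (GroupRing Γ) (Set.range (T cs φ)),
        heckeMk cs φ x * h ∈ Submodule.span (GroupRing Γ) (Set.range (T cs φ)) := by
    intro x
    induction x using FreeAlgebra.induction with
    | grade0 r =>
      intro h hh
      rw [AlgHom.commutes, ← Algebra.smul_def]
      exact Submodule.smul_mem _ _ hh
    | grade1 w => exact fun h hh => T_mul_mem_span cs φ w h hh
    | mul a b ha hb =>
      intro h hh
      rw [map_mul, mul_assoc]
      exact ha _ (hb _ hh)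
    | add a b ha hb =>
      intro h hh
      rw [map_add, add_mul]
      exact add_mem (ha _ hh) (hb _ hh)
  rintro h -
  obtain ⟨x, rfl⟩ := heckeMk_surjective cs φ h
  simpa using key x 1 (by rw [← T_one]; exact Submodule.subset_span ⟨_, rfl⟩)

variable {φ} in
/-- The basis `(T_w)` of the Hecke algebra. -/
noncomputable def TBasis (hφ : IsParameter cs φ) : Module.Basis W (GroupRing Γ) (Hecke cs φ) :=
  .mk (linearIndependent_T cs hφ) (span_T cs φ).ge

variable {φ} in
@[simp] theorem TBasis_apply (hφ : IsParameter cs φ) (w : W) : TBasis cs hφ w = T cs φ w := by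
  simp [TBasis]

end Free

end KLCells

namespace KLCells

/-! ### Negative parts and the bar involution on `ℤ[Γ]` -/

section NegativePart

theorem groupRing_ext {Γ : Type*} {a b : GroupRing Γ} (h : ∀ γ, a.coeff γ = b.coeff γ) : a = b :=
  AddMonoidAlgebra.ext (Finsupp.ext h)

variable {Γ : Type*} [AddCommGroup Γ]

theorem coeff_barScalar (a : GroupRing Γ) (γ : Γ) : (barScalar Γ a).coeff γ = a.coeff (-γ) := by
  have h : (barScalar Γ a).coeff = a.coeff.mapDomain (fun x => -x) := rfl
  rw [h]
  conv_lhs => rw [← neg_neg γ]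
  exact Finsupp.mapDomain_apply neg_injective _ _

theorem barScalar_barScalar (a : GroupRing Γ) : barScalar Γ (barScalar Γ a) = a :=
  groupRing_ext fun γ => by rw [coeff_barScalar, coeff_barScalar, neg_neg]

variable [LinearOrder Γ]

/-- The elements of `ℤ[Γ_{<0}]`. -/
def IsNegative (a : GroupRing Γ) : Prop := ∀ γ, 0 ≤ γ → a.coeff γ = 0

/-- The component in `ℤ[Γ_{<0}]` of an element of `ℤ[Γ]`. -/
noncomputable def negPart : GroupRing Γ →+ GroupRing Γ where
  toFun a := .ofCoeff (a.coeff.filter (· < 0))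
  map_zero' := by
    apply groupRing_ext
    simp [Finsupp.filter_zero]
  map_add' a b := by
    apply groupRing_ext
    intro γ
    simp [Finsupp.filter_add]

theorem coeff_negPart (a : GroupRing Γ) (γ : Γ) :
    (negPart a).coeff γ = if γ < 0 then a.coeff γ else 0 :=
  Finsupp.filter_apply _ _ _

theorem isNegative_negPart (a : GroupRing Γ) : IsNegative (negPart a) := fun γ h => by
  rw [coeff_negPart, if_neg (not_lt.2 h)]

variable [IsOrderedAddMonoid Γ]

/-- The coefficients of `a` are odd in `γ`, so the negative half determines the positive half up to
sign. -/
theorem negPart_sub_barScalar {a : GroupRing Γ} (h : barScalar Γ a = -a) :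
    negPart a - barScalar Γ (negPart a) = a := by
  apply groupRing_ext
  intro γ
  have h1 : a.coeff (-γ) = - a.coeff γ := by
    rw [← coeff_barScalar, h]
    rfl
  rw [AddMonoidAlgebra.coeff_sub, Finsupp.sub_apply, coeff_barScalar, coeff_negPart, coeff_negPart,
    h1]
  rcases lt_trichotomy γ 0 with h2 | rfl | h2
  · rw [if_pos h2, if_neg (by simp [h2.le]), sub_zero]
  -- The constant coefficient is its own opposite, hence zero in `ℤ`.
  · rw [neg_zero] at h1
    simp
    omega
  · rw [if_neg h2.not_gt, if_pos (by simpa using h2)]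
    simp

theorem IsNegative.eq_zero {a : GroupRing Γ} (ha : IsNegative a) (h : barScalar Γ a = a) :
    a = 0 := by
  apply groupRing_ext
  intro γ
  rcases le_total 0 γ with h1 | h1
  · exact ha γ h1
  · rw [← h, coeff_barScalar]
    exact ha _ (by simpa using h1)

end NegativePart

/-! ### Unitriangularity of the bar involution for the length -/

section LengthFiltration

variable {B W : Type*} [Group W] {M : CoxeterMatrix B} (cs : CoxeterSystem M W)
variable {Γ : Type*} [AddCommGroup Γ] (φ : B → Γ)

/-- The span of the `T_w` with `ℓ(w) < n`. -/
noncomputable def lowT (n : ℕ) : Submodule (GroupRing Γ) (Hecke cs φ) :=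
  Submodule.span _ (T cs φ '' {w | cs.length w < n})

theorem T_mem_lowT {n : ℕ} {w : W} (h : cs.length w < n) : T cs φ w ∈ lowT cs φ n :=
  Submodule.subset_span ⟨w, h, rfl⟩

theorem lowT_mono {m n : ℕ} (h : m ≤ n) : lowT cs φ m ≤ lowT cs φ n :=
  Submodule.span_mono (Set.image_mono fun _ hw => lt_of_lt_of_le hw h)

theorem lowT_zero : lowT cs φ 0 = ⊥ := by simp [lowT]

variable {φ} in
theorem mem_lowT_iff (hφ : IsParameter cs φ) {n : ℕ} {h : Hecke cs φ} :
    h ∈ lowT cs φ n ↔ ∀ w, n ≤ cs.length w → (TBasis cs hφ).repr h w = 0 := by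
  have h1 : T cs φ = TBasis cs hφ := funext fun w => (TBasis_apply cs hφ w).symm
  rw [lowT, h1, Module.Basis.mem_span_image]
  constructor
  · intro h w hw
    by_contra hc
    exact absurd (h (Finsupp.mem_support_iff.2 hc)) (not_lt.2 hw)
  · intro h w hw
    by_contra hc
    exact Finsupp.mem_support_iff.1 hw (h w (not_lt.1 hc))

variable {φ} in
theorem exists_mem_lowT (hφ : IsParameter cs φ) (h : Hecke cs φ) : ∃ n, h ∈ lowT cs φ n := by
  refine ⟨((TBasis cs hφ).repr h).support.sup cs.length + 1, (mem_lowT_iff cs hφ).2 fun w hw => ?_⟩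
  by_contra hc
  have := Finset.le_sup (f := cs.length) (Finsupp.mem_support_iff.2 hc)
  omega

theorem T_simple_mul_mem_lowT (i : B) {n : ℕ} {h : Hecke cs φ} (hh : h ∈ lowT cs φ n) :
    T cs φ (cs.simple i) * h ∈ lowT cs φ (n + 1) := by
  induction hh using Submodule.span_induction with
  | mem x hx =>
    obtain ⟨y, hy, rfl⟩ := hx
    have hy : cs.length y < n := hy
    by_cases hd : cs.IsLeftDescent y i
    · rw [T_simple_mul_of_descent cs φ i y hd]
      have := cs.isLeftDescent_iff.1 hd
      exact add_mem (T_mem_lowT cs φ (by omega))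
        (Submodule.smul_mem _ _ (T_mem_lowT cs φ (by omega)))
    · rw [T_simple_mul_of_not_descent cs φ i y hd]
      have := cs.not_isLeftDescent_iff.1 hd
      exact T_mem_lowT cs φ (by omega)
  | zero => simp
  | add x y _ _ hx hy => rw [mul_add]; exact add_mem hx hy
  | smul a x _ hx => rw [mul_smul_comm]; exact Submodule.smul_mem _ _ hx

theorem bar_smul (a : GroupRing Γ) (h : Hecke cs φ) :
    bar cs φ (a • h) = barScalar Γ a • bar cs φ h := by
  rw [Algebra.smul_def, map_mul, bar_algebraMap, ← Algebra.smul_def]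

theorem bar_T_mul (w : W) : bar cs φ (T cs φ w) * T cs φ w⁻¹ = 1 := by
  rw [bar_T, ← coe_TUnit, Units.inv_mul]

theorem bar_T_simple (i : B) : bar cs φ (T cs φ (cs.simple i)) =
    T cs φ (cs.simple i) - heckeCoeff φ i • 1 := by
  have h : T cs φ (cs.simple i) * (T cs φ (cs.simple i) - heckeCoeff φ i • 1) = 1 := by
    rw [mul_sub, T_simple_sq', mul_smul_comm, mul_one, add_sub_cancel_right]
  have h1 := bar_T_mul cs φ (cs.simple i)
  rw [cs.inv_simple] at h1
  calc _ = bar cs φ (T cs φ (cs.simple i)) *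
        (T cs φ (cs.simple i) * (T cs φ (cs.simple i) - heckeCoeff φ i • 1)) := by rw [h, mul_one]
    _ = _ := by rw [← mul_assoc, h1, one_mul]

/-- Induction along `T_w = T_s T_u`, since `T_s` and its bar differ by a scalar. Filtering by length
takes the place of the Bruhat order. -/
theorem bar_T_sub_mem (w : W) : bar cs φ (T cs φ w) - T cs φ w ∈ lowT cs φ (cs.length w) := by
  induction hn : cs.length w generalizing w with
  | zero => rw [cs.length_eq_zero_iff.1 hn, T_one, map_one, sub_self]; exact zero_mem _
  | succ n ih =>
    have hw : w ≠ 1 := by rintro rfl; simp at hn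
    obtain ⟨i, hi⟩ := cs.exists_leftDescent_of_ne_one hw
    have hi' := cs.isLeftDescent_iff.1 hi
    have h1 := T_simple_mul_of_not_descent cs φ i _
      (cs.isLeftDescent_iff_not_isLeftDescent_mul.1 hi)
    rw [cs.simple_mul_simple_cancel_left] at h1
    have h2 := ih (cs.simple i * w) (by omega)
    set u := cs.simple i * w with hu
    obtain ⟨g, hg, hgu⟩ : ∃ g ∈ lowT cs φ n, bar cs φ (T cs φ u) = T cs φ u + g :=
      ⟨_, h2, by abel⟩
    have h3 : bar cs φ (T cs φ w) - T cs φ w =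
        T cs φ (cs.simple i) * g - heckeCoeff φ i • T cs φ u - heckeCoeff φ i • g := by
      rw [← h1, map_mul, hgu, bar_T_simple, sub_mul, mul_add, smul_mul_assoc, one_mul, smul_add]
      abel
    rw [h3]
    refine sub_mem (sub_mem (T_simple_mul_mem_lowT cs φ i hg) ?_) ?_
    · exact Submodule.smul_mem _ _ (T_mem_lowT cs φ (by omega))
    · exact Submodule.smul_mem _ _ (lowT_mono cs φ (Nat.le_succ n) hg)

theorem bar_bar (h : Hecke cs φ) : bar cs φ (bar cs φ h) = h := by
  have hh : h ∈ Submodule.span (GroupRing Γ) (Set.range (T cs φ)) := by rw [span_T]; trivial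
  induction hh using Submodule.span_induction with
  | mem x hx =>
    obtain ⟨w, rfl⟩ := hx
    have h1 := congrArg (bar cs φ) (bar_T_mul cs φ w)
    have h2 := bar_T_mul cs φ w⁻¹
    rw [map_mul, map_one] at h1
    rw [inv_inv] at h2
    calc _ = bar cs φ (bar cs φ (T cs φ w)) * (bar cs φ (T cs φ w⁻¹) * T cs φ w) := by
          rw [h2, mul_one]
      _ = _ := by rw [← mul_assoc, h1, one_mul]
  | zero => simp
  | add x y _ _ hx hy => rw [map_add, map_add, hx, hy]
  | smul a x _ hx => rw [bar_smul, bar_smul, barScalar_barScalar, hx]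

variable {φ}

/-- The application of an additive map to the coefficients in the basis `(T_w)`. -/
noncomputable def coeffMap (hφ : IsParameter cs φ) (f : GroupRing Γ →+ GroupRing Γ) :
    Hecke cs φ →+ Hecke cs φ :=
  ((TBasis cs hφ).repr.symm.toLinearMap.toAddMonoidHom.comp (Finsupp.mapRange.addMonoidHom f)).comp
    (TBasis cs hφ).repr.toLinearMap.toAddMonoidHom

theorem repr_coeffMap (hφ : IsParameter cs φ) (f : GroupRing Γ →+ GroupRing Γ) (h : Hecke cs φ)
    (w : W) : (TBasis cs hφ).repr (coeffMap cs hφ f h) w = f ((TBasis cs hφ).repr h w) := by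
  simp [coeffMap]

theorem coeffMap_T (hφ : IsParameter cs φ) (w : W) :
    coeffMap cs hφ (barScalar Γ : GroupRing Γ →+ GroupRing Γ) (T cs φ w) = T cs φ w := by
  apply (TBasis cs hφ).repr.injective
  ext1 x
  rw [repr_coeffMap, ← TBasis_apply cs hφ, Module.Basis.repr_self]
  classical
  rw [Finsupp.single_apply]
  split_ifs <;> simp

theorem coeffMap_smul (hφ : IsParameter cs φ) (a : GroupRing Γ) (h : Hecke cs φ) :
    coeffMap cs hφ (barScalar Γ : GroupRing Γ →+ GroupRing Γ) (a • h) =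
      barScalar Γ a • coeffMap cs hφ (barScalar Γ : GroupRing Γ →+ GroupRing Γ) h := by
  apply (TBasis cs hφ).repr.injective
  ext1 x
  rw [repr_coeffMap, map_smul, map_smul, Finsupp.smul_apply, Finsupp.smul_apply, repr_coeffMap]
  simp

/-- Modulo shorter terms, bar only conjugates coefficients. This reduces existence and uniqueness of
`C_w` to statements about `ℤ[Γ]`, one length at a time. -/
theorem bar_sub_coeffMap_mem (hφ : IsParameter cs φ) {n : ℕ} {h : Hecke cs φ}
    (hh : h ∈ lowT cs φ (n + 1)) :
    bar cs φ h - coeffMap cs hφ (barScalar Γ : GroupRing Γ →+ GroupRing Γ) h ∈ lowT cs φ n := by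
  induction hh using Submodule.span_induction with
  | mem x hx =>
    obtain ⟨w, hw, rfl⟩ := hx
    rw [coeffMap_T]
    exact lowT_mono cs φ (Nat.lt_succ_iff.1 hw) (bar_T_sub_mem cs φ w)
  | zero => simp
  | add x y _ _ hx hy =>
    rw [map_add, map_add, add_sub_add_comm]
    exact add_mem hx hy
  | smul a x _ hx =>
    rw [bar_smul, coeffMap_smul, ← smul_sub]
    exact Submodule.smul_mem _ _ hx

end LengthFiltration

/-! ### Existence, uniqueness and freeness of the Kazhdan–Lusztig elements -/

section KLBasis

variable {B W : Type*} [Group W] {M : CoxeterMatrix B} (cs : CoxeterSystem M W)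
variable {Γ : Type*} [AddCommGroup Γ] [LinearOrder Γ] {φ : B → Γ}

theorem smul_T_mem_heckeNeg {a : GroupRing Γ} (ha : IsNegative a) (w : W) :
    a • T cs φ w ∈ heckeNeg cs φ := by
  have h : a = a.coeff.sum fun γ n => n • expo γ := by
    conv_lhs => rw [← AddMonoidAlgebra.sum_coeff_single a]
    simp [expo, AddMonoidAlgebra.smul_single]
  rw [h, Finsupp.sum, Finset.sum_smul]
  refine sum_mem fun γ hγ => ?_
  rw [smul_assoc]
  have hγ' : γ < 0 := by
    by_contra hc
    exact Finsupp.mem_support_iff.1 hγ (ha γ (not_lt.1 hc))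
  have hm : expo γ • T cs φ w ∈ heckeNeg cs φ := AddSubgroup.subset_closure ⟨γ, hγ', w, rfl⟩
  exact zsmul_mem hm _

theorem mem_heckeNeg_iff (hφ : IsParameter cs φ) {h : Hecke cs φ} :
    h ∈ heckeNeg cs φ ↔ ∀ w, IsNegative ((TBasis cs hφ).repr h w) := by
  classical
  constructor
  · intro hh
    induction hh using AddSubgroup.closure_induction with
    | mem x hx =>
      obtain ⟨γ, hγ, w, rfl⟩ := hx
      intro v δ hδ
      rw [map_smul, ← TBasis_apply cs hφ, Module.Basis.repr_self, Finsupp.smul_single,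
        Finsupp.single_apply]
      split_ifs with hv
      · rw [smul_eq_mul, mul_one, expo, AddMonoidAlgebra.coeff_single, Finsupp.single_apply,
          if_neg (lt_of_lt_of_le hγ hδ).ne]
      · rfl
    | zero => intro w γ _; simp
    | add x y _ _ hx hy =>
      intro w γ hγ
      rw [map_add, Finsupp.add_apply, AddMonoidAlgebra.coeff_add, Finsupp.add_apply, hx w γ hγ,
        hy w γ hγ, add_zero]
    | neg x _ hx =>
      intro w γ hγ
      rw [map_neg, Finsupp.neg_apply, AddMonoidAlgebra.coeff_neg, Finsupp.neg_apply, hx w γ hγ,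
        neg_zero]
  · intro hh
    rw [← (TBasis cs hφ).linearCombination_repr h, Finsupp.linearCombination_apply, Finsupp.sum]
    refine sum_mem fun w _ => ?_
    rw [TBasis_apply]
    exact smul_T_mem_heckeNeg cs (hh w) w

/-- The linear map `T_w ↦ C_w`. -/
noncomputable def TtoKL (hφ : IsParameter cs φ) : Hecke cs φ →ₗ[GroupRing Γ] Hecke cs φ :=
  (TBasis cs hφ).constr (GroupRing Γ) (KL cs φ)

theorem TtoKL_T (hφ : IsParameter cs φ) (w : W) : TtoKL cs hφ (T cs φ w) = KL cs φ w := by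
  rw [TtoKL, ← TBasis_apply cs hφ, Module.Basis.constr_basis]

variable [IsOrderedAddMonoid Γ]

/-- The coefficients of top length are both negative and bar-invariant, so they vanish; descend on
the length. -/
theorem eq_zero_of_bar_eq_of_mem_heckeNeg (hφ : IsParameter cs φ) {h : Hecke cs φ}
    (h1 : bar cs φ h = h) (h2 : h ∈ heckeNeg cs φ) : h = 0 := by
  have key : ∀ n, h ∈ lowT cs φ n → h ∈ lowT cs φ 0 := by
    intro n
    induction n with
    | zero => exact id
    | succ n ih =>
      intro hn
      refine ih ((mem_lowT_iff cs hφ).2 fun w hw => ?_)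
      have h3 := (mem_lowT_iff cs hφ).1 (bar_sub_coeffMap_mem cs hφ hn) w hw
      rw [h1, map_sub, Finsupp.sub_apply, repr_coeffMap, sub_eq_zero] at h3
      exact ((mem_heckeNeg_iff cs hφ).1 h2 w).eq_zero h3.symm
  obtain ⟨n, hn⟩ := exists_mem_lowT cs hφ h
  simpa [lowT_zero] using key n hn

theorem IsKL.unique (hφ : IsParameter cs φ) {w : W} {c d : Hecke cs φ} (hc : IsKL cs φ w c)
    (hd : IsKL cs φ w d) : c = d := by
  rw [← sub_eq_zero]
  refine eq_zero_of_bar_eq_of_mem_heckeNeg cs hφ (by rw [map_sub, hc.1, hd.1]) ?_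
  rw [← sub_sub_sub_cancel_right c d (T cs φ w)]
  exact sub_mem hc.2 hd.2

/-- The top coefficients of `h` are anti-invariant, so their negative parts solve the equation up to
shorter terms. The bound on the length of `g` is kept in order to make `C_w` unitriangular. -/
theorem exists_sub_bar_eq (hφ : IsParameter cs φ) (n : ℕ) (h : Hecke cs φ) (hn : h ∈ lowT cs φ n)
    (hb : bar cs φ h = -h) : ∃ g ∈ heckeNeg cs φ, g ∈ lowT cs φ n ∧ g - bar cs φ g = h := by
  induction n generalizing h with
  | zero =>
    obtain rfl : h = 0 := by simpa [lowT_zero] using hn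
    exact ⟨0, zero_mem _, zero_mem _, by simp⟩
  | succ n ih =>
    have h1 := bar_sub_coeffMap_mem cs hφ hn
    set g := coeffMap cs hφ negPart h with hg
    have hgn : g ∈ lowT cs φ (n + 1) := (mem_lowT_iff cs hφ).2 fun w hw => by
      rw [hg, repr_coeffMap, (mem_lowT_iff cs hφ).1 hn w hw, map_zero]
    have hgneg : g ∈ heckeNeg cs φ := (mem_heckeNeg_iff cs hφ).2 fun w => by
      rw [hg, repr_coeffMap]
      exact isNegative_negPart _
    have h2 := bar_sub_coeffMap_mem cs hφ hgn
    have h3 : h - (g - bar cs φ g) ∈ lowT cs φ n := by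
      refine (mem_lowT_iff cs hφ).2 fun w hw => ?_
      have h4 := (mem_lowT_iff cs hφ).1 h1 w hw
      have h5 := (mem_lowT_iff cs hφ).1 h2 w hw
      rw [map_sub, Finsupp.sub_apply, repr_coeffMap, sub_eq_zero] at h4 h5
      rw [map_sub, map_sub, Finsupp.sub_apply, Finsupp.sub_apply, h5, hg, repr_coeffMap]
      rw [hb, map_neg, Finsupp.neg_apply] at h4
      have := negPart_sub_barScalar h4.symm
      rw [sub_eq_zero]
      exact this.symm
    -- The remainder is again anti-invariant, since `g - bar g` is.
    obtain ⟨g', hg1, hg2, hg3⟩ := ih _ h3 (by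
      rw [map_sub, map_sub, hb, bar_bar]
      abel)
    refine ⟨g + g', add_mem hgneg hg1, add_mem hgn (lowT_mono cs φ (Nat.le_succ n) hg2), ?_⟩
    rw [map_add, add_sub_add_comm, hg3]
    abel

/-- The element `bar T_w - T_w` is anti-invariant, hence equal to some `g - bar g` with `g`
negative; then `T_w + g` is bar-invariant. -/
theorem exists_isKL (hφ : IsParameter cs φ) (w : W) :
    ∃ c, IsKL cs φ w c ∧ c - T cs φ w ∈ lowT cs φ (cs.length w) := by
  obtain ⟨g, hg1, hg2, hg3⟩ := exists_sub_bar_eq cs hφ _ _ (bar_T_sub_mem cs φ w) (by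
    rw [map_sub, bar_bar]
    abel)
  refine ⟨T cs φ w + g, ⟨?_, by simpa using hg1⟩, by simpa using hg2⟩
  rw [map_add, ← sub_eq_zero]
  rw [← sub_eq_zero] at hg3
  rw [← neg_eq_zero, ← hg3]
  abel

theorem isKL_KL (hφ : IsParameter cs φ) (w : W) : IsKL cs φ w (KL cs φ w) := by
  have h : ∃ c, IsKL cs φ w c := (exists_isKL cs hφ w).imp fun _ h => h.1
  rw [KL, dif_pos h]
  exact h.choose_spec

theorem IsKL.eq_KL (hφ : IsParameter cs φ) {w : W} {c : Hecke cs φ} (h : IsKL cs φ w c) :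
    c = KL cs φ w :=
  h.unique cs hφ (isKL_KL cs hφ w)

theorem KL_sub_T_mem (hφ : IsParameter cs φ) (w : W) :
    KL cs φ w - T cs φ w ∈ lowT cs φ (cs.length w) := by
  obtain ⟨c, hc, h⟩ := exists_isKL cs hφ w
  rwa [hc.eq_KL cs hφ] at h

theorem TtoKL_sub_mem (hφ : IsParameter cs φ) {n : ℕ} {h : Hecke cs φ}
    (hh : h ∈ lowT cs φ (n + 1)) : TtoKL cs hφ h - h ∈ lowT cs φ n := by
  induction hh using Submodule.span_induction with
  | mem x hx =>
    obtain ⟨w, hw, rfl⟩ := hx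
    rw [TtoKL_T]
    exact lowT_mono cs φ (Nat.lt_succ_iff.1 hw) (KL_sub_T_mem cs hφ w)
  | zero => simp
  | add x y _ _ hx hy =>
    rw [map_add, add_sub_add_comm]
    exact add_mem hx hy
  | smul a x _ hx =>
    rw [map_smul, ← smul_sub]
    exact Submodule.smul_mem _ _ hx

/-- The map is the identity plus a map lowering the length filtration. That filtration starts at `0`
and is exhaustive, so `W` may be infinite. -/
theorem TtoKL_bijective (hφ : IsParameter cs φ) : Function.Bijective (TtoKL cs hφ) := by
  constructor
  · rw [← LinearMap.ker_eq_bot, LinearMap.ker_eq_bot']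
    intro h hh
    obtain ⟨n, hn⟩ := exists_mem_lowT cs hφ h
    induction n with
    | zero => simpa [lowT_zero] using hn
    | succ n ih =>
      have := TtoKL_sub_mem cs hφ hn
      rw [hh, zero_sub, neg_mem_iff] at this
      exact ih this
  · intro h
    obtain ⟨n, hn⟩ := exists_mem_lowT cs hφ h
    induction n generalizing h with
    | zero =>
      obtain rfl : h = 0 := by simpa [lowT_zero] using hn
      exact ⟨0, map_zero _⟩
    | succ n ih =>
      obtain ⟨g, hg⟩ := ih _ (TtoKL_sub_mem cs hφ hn)
      exact ⟨h - g, by rw [map_sub, hg]; abel⟩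

/-- The Kazhdan–Lusztig basis. -/
noncomputable def KLBasis (hφ : IsParameter cs φ) : Module.Basis W (GroupRing Γ) (Hecke cs φ) :=
  (TBasis cs hφ).map (LinearEquiv.ofBijective (TtoKL cs hφ) (TtoKL_bijective cs hφ))

@[simp] theorem KLBasis_apply (hφ : IsParameter cs φ) (w : W) :
    KLBasis cs hφ w = KL cs φ w := by
  rw [KLBasis, Module.Basis.map_apply, TBasis_apply, LinearEquiv.ofBijective_apply, TtoKL_T]

end KLBasis

end KLCells

namespace KLCells

/-! ### The Coxeter system `(W̃, J̃)` and the decomposition `W = W̃ ⋊ W_I` -/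

section Tilde

variable {B W : Type*} [Group W] {M : CoxeterMatrix B} (cs : CoxeterSystem M W) (I : Set B)

theorem conj_mem_tildeJ {a t : W} (ha : a ∈ parabolic cs I) (ht : t ∈ tildeJ cs I) :
    a * t * a⁻¹ ∈ tildeJ cs I := by
  obtain ⟨j, hj, w, hw, rfl⟩ := ht
  exact ⟨j, hj, a * w, mul_mem ha hw, by group⟩

theorem simple_mem_tildeJ {j : B} (hj : j ∉ I) : cs.simple j ∈ tildeJ cs I :=
  ⟨j, hj, 1, one_mem _, by simp⟩

theorem simple_mem_parabolic {i : B} (hi : i ∈ I) : cs.simple i ∈ parabolic cs I :=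
  Subgroup.subset_closure ⟨i, hi, rfl⟩

theorem tildeJ_mul_self {t : W} (ht : t ∈ tildeJ cs I) : t * t = 1 := by
  obtain ⟨j, hj, w, hw, rfl⟩ := ht
  simp [mul_assoc]

theorem tildeJ_inv {t : W} (ht : t ∈ tildeJ cs I) : t⁻¹ = t :=
  inv_eq_of_mul_eq_one_right (tildeJ_mul_self cs I ht)

theorem conj_mem_tildeW {a x : W} (ha : a ∈ parabolic cs I) (hx : x ∈ tildeW cs I) :
    a * x * a⁻¹ ∈ tildeW cs I := by
  induction hx using Subgroup.closure_induction with
  | mem t ht => exact Subgroup.subset_closure (conj_mem_tildeJ cs I ha ht)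
  | one => simp
  | mul x y _ _ hx hy =>
    have : a * (x * y) * a⁻¹ = (a * x * a⁻¹) * (a * y * a⁻¹) := by group
    rw [this]
    exact mul_mem hx hy
  | inv x _ hx =>
    have : a * x⁻¹ * a⁻¹ = (a * x * a⁻¹)⁻¹ := by group
    rw [this]
    exact inv_mem hx

instance : MulAction (parabolic cs I) (tildeJ cs I) where
  smul a t := ⟨a * t * (a : W)⁻¹, conj_mem_tildeJ cs I a.2 t.2⟩
  one_smul t := Subtype.ext (by change ((1 : parabolic cs I) : W) * t * _ = t; simp)
  mul_smul a b t := Subtype.ext (by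
    change ((a * b : parabolic cs I) : W) * t * ((a * b : parabolic cs I) : W)⁻¹ =
      a * (b * t * (b : W)⁻¹) * (a : W)⁻¹
    push_cast
    group)

theorem coe_parabolic_smul (a : parabolic cs I) (t : tildeJ cs I) :
    ((a • t : tildeJ cs I) : W) = a * t * (a : W)⁻¹ := rfl

/-- The matrix of the orders of the products of two elements of `J̃`. -/
noncomputable def tildeMatrix : CoxeterMatrix (tildeJ cs I) where
  M t t' := orderOf ((t : W) * t')
  isSymm := by
    ext t t'
    change orderOf ((t' : W) * t) = orderOf ((t : W) * t')
    rw [← orderOf_inv, mul_inv_rev, tildeJ_inv cs I t.2, tildeJ_inv cs I t'.2]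
  diagonal t := by
    rw [tildeJ_mul_self cs I t.2, orderOf_one]
  off_diagonal t t' h := by
    rw [Ne, orderOf_eq_one_iff, mul_eq_one_iff_eq_inv, tildeJ_inv cs I t'.2]
    exact fun h' => h (Subtype.ext h')

/-- The abstract Coxeter system with matrix `tildeMatrix`. -/
noncomputable abbrev tildeAbs : CoxeterSystem (tildeMatrix cs I) (tildeMatrix cs I).Group :=
  (tildeMatrix cs I).toCoxeterSystem

/-- The matrix entry is the order in `W`, so it divides `n`. Infinite order is recorded as `0`,
which is also the Coxeter convention for no relation. -/
theorem tildeAbs_pow (t t' : tildeJ cs I) {n : ℕ} (h : ((t : W) * t') ^ n = 1) :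
    ((tildeAbs cs I).simple t * (tildeAbs cs I).simple t') ^ n = 1 := by
  obtain ⟨k, rfl⟩ := orderOf_dvd_of_pow_eq_one h
  have := (tildeAbs cs I).simple_mul_simple_pow t t'
  change (_) ^ orderOf ((t : W) * t') = _ at this
  rw [pow_mul, this, one_pow]

theorem tildeAbs_smul_isLiftable (a : parabolic cs I) :
    (tildeMatrix cs I).IsLiftable fun t => (tildeAbs cs I).simple (a • t) := by
  intro t t'
  apply tildeAbs_pow
  rw [coe_parabolic_smul, coe_parabolic_smul]
  have h : (a : W) * t * (a : W)⁻¹ * (a * t' * (a : W)⁻¹) = a * (t * t') * (a : W)⁻¹ := by group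
  rw [h, conj_pow]
  change (a : W) * _ ^ orderOf ((t : W) * t') * (a : W)⁻¹ = 1
  rw [pow_orderOf_eq_one]
  simp

/-- The endomorphism of the abstract Coxeter group induced by conjugation by `a ∈ W_I`. -/
noncomputable def tildeAbsMap (a : parabolic cs I) :
    (tildeMatrix cs I).Group →* (tildeMatrix cs I).Group :=
  (tildeAbs cs I).lift ⟨_, tildeAbs_smul_isLiftable cs I a⟩

theorem tildeAbsMap_simple (a : parabolic cs I) (t : tildeJ cs I) :
    tildeAbsMap cs I a ((tildeAbs cs I).simple t) = (tildeAbs cs I).simple (a • t) :=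
  (tildeAbs cs I).lift_apply_simple _ _

theorem tildeAbsMap_comp (a b : parabolic cs I) :
    (tildeAbsMap cs I a).comp (tildeAbsMap cs I b) = tildeAbsMap cs I (a * b) :=
  (tildeAbs cs I).ext_simple fun t => by
    rw [MonoidHom.comp_apply, tildeAbsMap_simple, tildeAbsMap_simple, tildeAbsMap_simple, mul_smul]

theorem tildeAbsMap_one : tildeAbsMap cs I 1 = MonoidHom.id _ :=
  (tildeAbs cs I).ext_simple fun t => by
    rw [tildeAbsMap_simple, one_smul, MonoidHom.id_apply]

/-- The action of `W_I` on the abstract Coxeter group. -/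
noncomputable def tildeAbsAut : parabolic cs I →* MulAut (tildeMatrix cs I).Group where
  toFun a := MonoidHom.toMulEquiv (tildeAbsMap cs I a) (tildeAbsMap cs I a⁻¹)
    (by rw [tildeAbsMap_comp, inv_mul_cancel, tildeAbsMap_one])
    (by rw [tildeAbsMap_comp, mul_inv_cancel, tildeAbsMap_one])
  map_one' := MulEquiv.ext fun x => DFunLike.congr_fun (tildeAbsMap_one cs I) x
  map_mul' a b := MulEquiv.ext fun x => DFunLike.congr_fun (tildeAbsMap_comp cs I a b).symm x

theorem tildeAbsAut_simple (a : parabolic cs I) (t : tildeJ cs I) :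
    tildeAbsAut cs I a ((tildeAbs cs I).simple t) = (tildeAbs cs I).simple (a • t) :=
  tildeAbsMap_simple cs I a t

open Classical in
/-- The images of the simple reflections of `W` in the semidirect product. -/
noncomputable def semidirectSimple (i : B) :
    (tildeMatrix cs I).Group ⋊[tildeAbsAut cs I] (parabolic cs I) :=
  if h : i ∈ I then SemidirectProduct.inr ⟨cs.simple i, simple_mem_parabolic cs I h⟩
  else SemidirectProduct.inl ((tildeAbs cs I).simple ⟨cs.simple i, simple_mem_tildeJ cs I h⟩)

variable {I}

/-- If `M i j = 2k + 1`, then `r = s_i s_j` satisfies `r^k s_i r⁻ᵏ = r^{2k} s_i = r⁻¹ s_i = s_j`. -/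
theorem even_of_not_isConj {i j : B} (h : ¬ IsConj (cs.simple i) (cs.simple j)) :
    Even (M i j) := by
  by_contra ho
  obtain ⟨k, hk⟩ := Nat.not_even_iff_odd.1 ho
  apply h
  have h1 := cs.simple_mul_simple_pow i j
  rw [hk] at h1
  set r := cs.simple i * cs.simple j with hr
  have hc : cs.simple i * r⁻¹ = r * cs.simple i := by simp [hr, mul_assoc]
  have hcm : ∀ k : ℕ, cs.simple i * (r⁻¹) ^ k = r ^ k * cs.simple i := by
    intro k
    induction k with
    | zero => simp
    | succ k ihk => rw [pow_succ, ← mul_assoc, ihk, mul_assoc, hc, ← mul_assoc, ← pow_succ]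
  refine isConj_iff.2 ⟨r ^ k, ?_⟩
  rw [← inv_pow, mul_assoc, hcm, ← mul_assoc, ← pow_add, ← two_mul]
  rw [pow_succ, mul_eq_one_iff_eq_inv] at h1
  rw [h1, hr]
  simp

/-- The exponent is some `2k`, and the square of the product is `(s_i s_j s_i) s_j`, which lies in
the normal factor as a product of two elements of `J̃`. Its `k`-th power is then trivial by
`tildeAbs_pow`. -/
theorem semidirect_mixed_pow {i j : B} (hi : i ∈ I) (hj : j ∉ I)
    (h : ¬ IsConj (cs.simple i) (cs.simple j)) :
    (semidirectSimple cs I i * semidirectSimple cs I j) ^ M i j = 1 := by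
  obtain ⟨k, hk⟩ := even_of_not_isConj cs h
  have h1 := cs.simple_mul_simple_pow i j
  rw [hk, ← two_mul, pow_mul, sq] at h1 ⊢
  rw [semidirectSimple, semidirectSimple, dif_pos hi, dif_neg hj]
  set a : parabolic cs I := ⟨cs.simple i, simple_mem_parabolic cs I hi⟩ with ha
  set t : tildeJ cs I := ⟨cs.simple j, simple_mem_tildeJ cs I hj⟩ with ht
  have haa : a⁻¹ = a := Subtype.ext (by simp [ha])
  have h2 : ∀ x : (tildeMatrix cs I).Group,
      (SemidirectProduct.inr a : (tildeMatrix cs I).Group ⋊[tildeAbsAut cs I] (parabolic cs I)) *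
        SemidirectProduct.inl x * (SemidirectProduct.inr a * SemidirectProduct.inl x) =
      SemidirectProduct.inl (tildeAbsAut cs I a x * x) := by
    intro x
    rw [map_mul, SemidirectProduct.inl_aut, haa]
    group
  rw [h2, tildeAbsAut_simple, ← map_pow, tildeAbs_pow, map_one]
  rw [coe_parabolic_smul, ← h1]
  simp [ha, ht, mul_assoc]

theorem semidirectSimple_mul_self (i : B) :
    semidirectSimple cs I i * semidirectSimple cs I i = 1 := by
  rw [semidirectSimple]
  split_ifs with h
  · rw [← map_mul, ← map_one SemidirectProduct.inr]
    congr 1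
    exact Subtype.ext (cs.simple_mul_simple_self i)
  · rw [← map_mul, CoxeterSystem.simple_mul_simple_self, map_one]

theorem semidirectSimple_isLiftable
    (hI : ∀ i ∈ I, ∀ j ∉ I, ¬ IsConj (cs.simple i) (cs.simple j)) :
    M.IsLiftable (semidirectSimple cs I) := by
  intro i j
  by_cases hi : i ∈ I <;> by_cases hj : j ∈ I
  · rw [semidirectSimple, semidirectSimple, dif_pos hi, dif_pos hj, ← map_mul, ← map_pow]
    rw [← map_one SemidirectProduct.inr]
    congr 1
    exact Subtype.ext (cs.simple_mul_simple_pow i j)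
  · exact semidirect_mixed_pow cs hi hj (hI i hi j hj)
  · have h := semidirect_mixed_pow cs hj hi (hI j hj i hi)
    rw [M.symmetric, ← inv_eq_one, ← inv_pow, mul_inv_rev,
      inv_eq_of_mul_eq_one_right (semidirectSimple_mul_self cs i),
      inv_eq_of_mul_eq_one_right (semidirectSimple_mul_self cs j)] at h
    exact h
  · rw [semidirectSimple, semidirectSimple, dif_neg hi, dif_neg hj, ← map_mul, ← map_pow,
      tildeAbs_pow, map_one]
    exact cs.simple_mul_simple_pow i j

variable (hI : ∀ i ∈ I, ∀ j ∉ I, ¬ IsConj (cs.simple i) (cs.simple j))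

/-- The morphism from `W` to the semidirect product. -/
noncomputable def toSemidirect :
    W →* (tildeMatrix cs I).Group ⋊[tildeAbsAut cs I] (parabolic cs I) :=
  cs.lift ⟨semidirectSimple cs I, semidirectSimple_isLiftable cs hI⟩

theorem toSemidirect_simple (i : B) :
    toSemidirect cs hI (cs.simple i) = semidirectSimple cs I i :=
  cs.lift_apply_simple _ _

theorem toSemidirect_parabolic (a : parabolic cs I) :
    toSemidirect cs hI a = SemidirectProduct.inr a := by
  obtain ⟨a, ha⟩ := a
  induction ha using Subgroup.closure_induction with
  | mem x hx =>
    obtain ⟨i, hi, rfl⟩ := hx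
    rw [toSemidirect_simple, semidirectSimple, dif_pos hi]
  | one => rw [map_one]; exact (map_one SemidirectProduct.inr).symm
  | mul x y hx hy h1 h2 =>
    rw [map_mul, h1, h2, ← map_mul]
    rfl
  | inv x hx h1 =>
    rw [map_inv, h1, ← map_inv]
    rfl

theorem toSemidirect_tildeJ (t : tildeJ cs I) :
    toSemidirect cs hI t = SemidirectProduct.inl ((tildeAbs cs I).simple t) := by
  obtain ⟨j, hj, w, hw, ht⟩ := t.2
  have h : t = (⟨w, hw⟩ : parabolic cs I) • ⟨cs.simple j, simple_mem_tildeJ cs I hj⟩ :=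
    Subtype.ext ht
  have hw' := toSemidirect_parabolic cs hI ⟨w, hw⟩
  rw [ht, h, ← tildeAbsAut_simple, SemidirectProduct.inl_aut, map_mul, map_mul, map_inv,
    toSemidirect_simple, hw', semidirectSimple, dif_neg hj, map_inv]

theorem tildeAbs_coe_isLiftable :
    (tildeMatrix cs I).IsLiftable fun t =>
      (⟨t, Subgroup.subset_closure t.2⟩ : tildeW cs I) := fun t t' =>
  Subtype.ext (pow_orderOf_eq_one ((t : W) * t'))

variable (I) in
/-- The morphism from the abstract Coxeter group to `W̃`. -/
noncomputable def fromTildeAbs : (tildeMatrix cs I).Group →* tildeW cs I :=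
  (tildeAbs cs I).lift ⟨_, tildeAbs_coe_isLiftable cs⟩

theorem coe_fromTildeAbs_simple (t : tildeJ cs I) :
    (fromTildeAbs cs I ((tildeAbs cs I).simple t) : W) = t :=
  congrArg Subtype.val ((tildeAbs cs I).lift_apply_simple (tildeAbs_coe_isLiftable cs) t)

theorem toSemidirect_fromTildeAbs (x : (tildeMatrix cs I).Group) :
    toSemidirect cs hI (fromTildeAbs cs I x) = SemidirectProduct.inl x := by
  have h : ((toSemidirect cs hI).comp (tildeW cs I).subtype).comp (fromTildeAbs cs I) =
      SemidirectProduct.inl := (tildeAbs cs I).ext_simple fun t => by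
    rw [MonoidHom.comp_apply, MonoidHom.comp_apply, Subgroup.subtype_apply,
      coe_fromTildeAbs_simple, toSemidirect_tildeJ]
  exact DFunLike.congr_fun h x

/-- Injectivity is the point: followed by `toSemidirect`, the map becomes the inclusion of the
normal factor. -/
theorem fromTildeAbs_bijective
    (hI : ∀ i ∈ I, ∀ j ∉ I, ¬ IsConj (cs.simple i) (cs.simple j)) : Function.Bijective (fromTildeAbs cs I) := by
  constructor
  · intro x y h
    apply SemidirectProduct.inl_injective (φ := tildeAbsAut cs I)
    rw [← toSemidirect_fromTildeAbs cs hI, ← toSemidirect_fromTildeAbs cs hI, h]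
  · rintro ⟨x, hx⟩
    induction hx using Subgroup.closure_induction with
    | mem t ht => exact ⟨_, Subtype.ext (coe_fromTildeAbs_simple cs ⟨t, ht⟩)⟩
    | one => exact ⟨1, map_one _⟩
    | mul x y hx hy h1 h2 =>
      obtain ⟨a, ha⟩ := h1
      obtain ⟨b, hb⟩ := h2
      exact ⟨a * b, by rw [map_mul, ha, hb]; rfl⟩
    | inv x hx h1 =>
      obtain ⟨a, ha⟩ := h1
      exact ⟨a⁻¹, by rw [map_inv, ha]; rfl⟩

/-- The Coxeter system `(W̃, J̃)`. -/
noncomputable def tildeSystem : CoxeterSystem (tildeMatrix cs I) (tildeW cs I) :=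
  (tildeAbs cs I).map (MulEquiv.ofBijective _ (fromTildeAbs_bijective cs hI))

theorem coe_tildeSystem_simple (t : tildeJ cs I) : ((tildeSystem cs hI).simple t : W) = t :=
  coe_fromTildeAbs_simple cs t

/-- The retraction of `W` onto `W_I` with kernel `W̃`. -/
noncomputable def retract : W →* parabolic cs I :=
  SemidirectProduct.rightHom.comp (toSemidirect cs hI)

theorem retract_parabolic (a : parabolic cs I) : retract cs hI a = a := by
  rw [retract, MonoidHom.comp_apply, toSemidirect_parabolic, SemidirectProduct.rightHom_inr]

theorem retract_tildeW (x : tildeW cs I) : retract cs hI x = 1 := by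
  obtain ⟨y, rfl⟩ := (fromTildeAbs_bijective cs hI).2 x
  rw [retract, MonoidHom.comp_apply, toSemidirect_fromTildeAbs, SemidirectProduct.rightHom_inl]

theorem retract_inv_mul_mem (w : W) : (retract cs hI w : W)⁻¹ * w ∈ tildeW cs I := by
  induction w using cs.simple_induction_left with
  | one => simp
  | mul_simple_left w i ih =>
    rw [map_mul]
    by_cases hi : i ∈ I
    · have := retract_parabolic cs hI ⟨_, simple_mem_parabolic cs I hi⟩
      rw [this]
      push_cast
      simpa [mul_assoc] using ih
    · have := retract_tildeW cs hI ⟨_, Subgroup.subset_closure (simple_mem_tildeJ cs I hi)⟩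
      rw [this, one_mul]
      -- A letter outside `I` moved past an element of `W_I` becomes a conjugate, which is still in
      -- `W̃`.
      have h : (retract cs hI w : W)⁻¹ * (cs.simple i * w) =
          ((retract cs hI w : W)⁻¹ * cs.simple i * ((retract cs hI w : W)⁻¹)⁻¹) *
            ((retract cs hI w : W)⁻¹ * w) := by group
      rw [h]
      exact mul_mem (conj_mem_tildeW cs I (inv_mem (retract cs hI w).2)
        (Subgroup.subset_closure (simple_mem_tildeJ cs I hi))) ih

/-- The component in `W̃` of an element of `W = W_I W̃`. -/
noncomputable def tildePart (w : W) : tildeW cs I :=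
  ⟨(retract cs hI w : W)⁻¹ * w, retract_inv_mul_mem cs hI w⟩

theorem retract_mul_tildePart (w : W) : (retract cs hI w : W) * tildePart cs hI w = w := by
  simp [tildePart]

theorem retract_mul (a : parabolic cs I) (x : tildeW cs I) : retract cs hI (a * x) = a := by
  rw [map_mul, retract_parabolic, retract_tildeW, mul_one]

theorem tildePart_mul (a : parabolic cs I) (x : tildeW cs I) : tildePart cs hI (a * x) = x :=
  Subtype.ext (by rw [tildePart]; simp [retract_mul])

theorem tildePart_coe (x : tildeW cs I) : tildePart cs hI x = x := by
  simpa using tildePart_mul cs hI 1 x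

theorem mem_parabolic_mul_iff (C : Set (tildeW cs I)) (w : W) :
    w ∈ (parabolic cs I : Set W) * ((↑) '' C : Set W) ↔ tildePart cs hI w ∈ C := by
  constructor
  · rintro ⟨a, ha, -, ⟨x, hx, rfl⟩, rfl⟩
    have := tildePart_mul cs hI ⟨a, ha⟩ x
    simpa [this] using hx
  · intro h
    exact ⟨_, (retract cs hI w).2, _, ⟨_, h, rfl⟩,
      retract_mul_tildePart cs hI w⟩

theorem isParameter_tildePhi {Γ : Type*} {φ : B → Γ} (hφ : IsParameter cs φ)
    {Mt : CoxeterMatrix (tildeJ cs I)} (cst : CoxeterSystem Mt (tildeW cs I))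
    (hst : ∀ t, (cst.simple t : W) = t) : IsParameter cst (tildePhi cs I φ) := by
  intro t t' h
  obtain ⟨x, hx⟩ := isConj_iff.1 h
  have hx := congrArg Subtype.val hx
  push_cast at hx
  rw [hst, hst] at hx
  obtain ⟨j, hj, w, hw, hjw⟩ := t.2
  rw [tildePhi_eq cs I φ hφ t j w hjw]
  refine (tildePhi_eq cs I φ hφ t' j (x * w) ?_).symm
  rw [← hx, hjw]
  group

end Tilde

end KLCells

namespace KLCells

/-! ### The length on `W̃` as a count of letters outside `I` -/

section TildeLength

variable {B W : Type*} [Group W] {M : CoxeterMatrix B} (cs : CoxeterSystem M W) {I : Set B}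
variable {Mt : CoxeterMatrix (tildeJ cs I)} (cst : CoxeterSystem Mt (tildeW cs I))

theorem exists_word_of_mem_parabolic {a : W} (ha : a ∈ parabolic cs I) :
    ∃ ω : List B, (∀ i ∈ ω, i ∈ I) ∧ cs.wordProd ω = a := by
  induction ha using Subgroup.closure_induction with
  | mem x hx =>
    obtain ⟨i, hi, rfl⟩ := hx
    exact ⟨[i], by simpa using hi, by simp⟩
  | one => exact ⟨[], by simp, by simp⟩
  | mul x y _ _ hx hy =>
    obtain ⟨ω, h1, rfl⟩ := hx
    obtain ⟨ω', h2, rfl⟩ := hy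
    refine ⟨ω ++ ω', fun i hi => ?_, cs.wordProd_append _ _⟩
    rcases List.mem_append.1 hi with h | h
    exacts [h1 i h, h2 i h]
  | inv x _ hx =>
    obtain ⟨ω, h1, rfl⟩ := hx
    exact ⟨ω.reverse, fun i hi => h1 i (List.mem_reverse.1 hi), cs.wordProd_reverse ω⟩

variable (I) in
open Classical in
/-- The number of letters of a word that are not in `I`. -/
noncomputable def countOutside (ω : List B) : ℕ := ω.countP (· ∉ I)

theorem countOutside_append (ω ω' : List B) :
    countOutside I (ω ++ ω') = countOutside I ω + countOutside I ω' :=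
  List.countP_append

theorem countOutside_cons_of_mem {i : B} (hi : i ∈ I) (ω : List B) :
    countOutside I (i :: ω) = countOutside I ω := by
  simp [countOutside, hi]

theorem countOutside_cons_of_notMem {i : B} (hi : i ∉ I) (ω : List B) :
    countOutside I (i :: ω) = countOutside I ω + 1 := by
  simp [countOutside, hi]

theorem countOutside_eq_zero {ω : List B} (h : ∀ i ∈ ω, i ∈ I) : countOutside I ω = 0 := by
  simpa [countOutside, List.countP_eq_zero] using h

variable {cs} in
theorem conj_wordProd (hst : ∀ t, (cst.simple t : W) = t) (a : parabolic cs I)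
    (ω : List (tildeJ cs I)) :
    (cst.wordProd (ω.map (a • ·)) : W) = a * cst.wordProd ω * (a : W)⁻¹ := by
  induction ω with
  | nil => simp
  | cons t ω ih =>
    rw [List.map_cons, cst.wordProd_cons, cst.wordProd_cons]
    push_cast
    rw [ih, hst, hst, coe_parabolic_smul]
    group

/-- Letters of `I` are pushed to the right. They conjugate the letters they pass within `J̃`, so
each letter outside `I` yields exactly one letter of `J̃`. -/
theorem exists_tilde_word (hst : ∀ t, (cst.simple t : W) = t) (ω : List B) :
    ∃ (ω' : List (tildeJ cs I)) (a : parabolic cs I), ω'.length = countOutside I ω ∧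
      cs.wordProd ω = cst.wordProd ω' * a := by
  induction ω with
  | nil => exact ⟨[], 1, rfl, by simp⟩
  | cons i ω ih =>
    obtain ⟨ω', a, h1, h2⟩ := ih
    by_cases hi : i ∈ I
    · refine ⟨ω'.map ((⟨_, simple_mem_parabolic cs I hi⟩ : parabolic cs I) • ·),
        ⟨_, simple_mem_parabolic cs I hi⟩ * a, ?_, ?_⟩
      · rw [List.length_map, h1, countOutside_cons_of_mem hi]
      · rw [conj_wordProd cst hst, cs.wordProd_cons, h2]
        simp [mul_assoc]
    · refine ⟨⟨_, simple_mem_tildeJ cs I hi⟩ :: ω', a, ?_, ?_⟩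
      · rw [List.length_cons, h1, countOutside_cons_of_notMem hi]
      · rw [cs.wordProd_cons, h2, cst.wordProd_cons]
        push_cast
        rw [hst, mul_assoc]

/-- Each `w s_j w⁻¹` in `J̃` costs exactly one letter outside `I`, the words for elements of `W_I`
being free. The resulting word need not be reduced. -/
theorem exists_word_of_tilde_word (hst : ∀ t, (cst.simple t : W) = t)
    (ω' : List (tildeJ cs I)) (a : parabolic cs I) :
    ∃ ω : List B, countOutside I ω = ω'.length ∧ cs.wordProd ω = a * cst.wordProd ω' := by
  induction ω' generalizing a with
  | nil =>
    obtain ⟨ω, h1, h2⟩ := exists_word_of_mem_parabolic cs a.2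
    exact ⟨ω, countOutside_eq_zero h1, by simpa using h2⟩
  | cons t ω' ih =>
    obtain ⟨j, hj, w, hw, ht⟩ := t.2
    obtain ⟨ω, h1, h2⟩ := ih ⟨w⁻¹, inv_mem hw⟩
    obtain ⟨ω₁, h3, h4⟩ := exists_word_of_mem_parabolic cs (mul_mem a.2 hw)
    refine ⟨ω₁ ++ j :: ω, ?_, ?_⟩
    · rw [countOutside_append, countOutside_eq_zero h3, countOutside_cons_of_notMem hj, h1,
        List.length_cons, zero_add]
    · rw [cs.wordProd_append, cs.wordProd_cons, h2, h4, cst.wordProd_cons]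
      push_cast
      rw [hst, ht]
      group

/-- Represent `a⁻¹ x` by a word with only `ℓ(x)` letters outside `I`, length being taken in `W̃`.
Exchange deletes one of these letters, so `t x` is shorter than `x` in `W̃`. -/
theorem isLeftDescent_tilde (hI : ∀ i ∈ I, ∀ j ∉ I, ¬ IsConj (cs.simple i) (cs.simple j))
    (hst : ∀ t, (cst.simple t : W) = t) {t : tildeJ cs I} {j : B} (hj : j ∉ I)
    {a : parabolic cs I} (ht : (t : W) = a * cs.simple j * (a : W)⁻¹) (x : tildeW cs I)
    (h : cs.IsLeftDescent ((a : W)⁻¹ * x) j) : cst.IsLeftDescent x t := by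
  obtain ⟨ω', hω', rfl⟩ := cst.exists_isReduced x
  obtain ⟨ω, h1, h2⟩ := exists_word_of_tilde_word cs cst hst ω' a⁻¹
  push_cast at h2
  rw [← h2] at h
  obtain ⟨ω₁, k, ω₂, rfl, hk, he⟩ := exists_exchange cs h
  -- The deleted letter is conjugate to `s_j`, so it is not in `I` and its deletion lowers the
  -- count.
  have hkI : k ∉ I := fun hkI => hI k hkI j hj (isConj_iff.2 ⟨_, hk.symm⟩)
  rw [countOutside_append, countOutside_cons_of_notMem hkI] at h1
  obtain ⟨ω₃, b, h3, h4⟩ := exists_tilde_word cs cst hst (ω₁ ++ ω₂)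
  rw [countOutside_append] at h3
  -- Here `t x = a ω₃ b`. Moving `b` to the left conjugates `ω₃` by `b⁻¹` without changing its
  -- length; comparing components in `W̃` then removes `a b`.
  have h5 : ((cst.simple t * cst.wordProd ω' : tildeW cs I) : W) =
      ((a * b : parabolic cs I) : W) *
        (cst.wordProd (ω₃.map ((b⁻¹ : parabolic cs I) • ·)) : tildeW cs I) := by
    rw [conj_wordProd cst hst]
    push_cast
    rw [hst, ht, mul_assoc, mul_assoc, ← h2, he, h4]
    group
  have h6 := congrArg (fun w => tildePart cs hI w) h5
  simp only [tildePart_coe, tildePart_mul] at h6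
  rw [CoxeterSystem.IsLeftDescent, h6, hω'.eq]
  refine lt_of_le_of_lt (cst.length_wordProd_le _) ?_
  rw [List.length_map]
  omega

end TildeLength

/-! ### The Hecke algebra of `W̃` inside that of `W` -/

section TildeHecke

variable {B W : Type*} [Group W] {M : CoxeterMatrix B} (cs : CoxeterSystem M W) {I : Set B}
variable {Γ : Type*} [AddCommGroup Γ] {φ : B → Γ}

theorem heckeCoeff_eq_zero {i : B} (h : φ i = 0) : heckeCoeff φ i = 0 := by
  rw [heckeCoeff, h, neg_zero, sub_self]

/-- The correction term in the descent case has coefficient `e^0 - e^0 = 0`. -/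
theorem T_simple_mul_of_zero {i : B} (h : φ i = 0) (w : W) :
    T cs φ (cs.simple i) * T cs φ w = T cs φ (cs.simple i * w) := by
  by_cases hd : cs.IsLeftDescent w i
  · rw [T_simple_mul_of_descent cs φ i w hd, heckeCoeff_eq_zero h, zero_smul, add_zero]
  · exact T_simple_mul_of_not_descent cs φ i w hd

theorem T_mul_simple_of_zero {i : B} (h : φ i = 0) (w : W) :
    T cs φ w * T cs φ (cs.simple i) = T cs φ (w * cs.simple i) := by
  by_cases hd : cs.IsRightDescent w i
  · have h1 := cs.isRightDescent_iff.1 hd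
    have h2 : T cs φ (w * cs.simple i) * T cs φ (cs.simple i) = T cs φ w := by
      rw [T_mul, cs.simple_mul_simple_cancel_right]
      rw [cs.simple_mul_simple_cancel_right, cs.length_simple, h1]
    rw [← h2, mul_assoc, T_simple_mul_of_zero cs h, cs.simple_mul_simple_self, T_one, mul_one]
  · rw [T_mul]
    rw [cs.not_isRightDescent_iff.1 hd, cs.length_simple]

theorem T_parabolic_mul (hφI : ∀ i ∈ I, φ i = 0) {a : W} (ha : a ∈ parabolic cs I) (w : W) :
    T cs φ a * T cs φ w = T cs φ (a * w) := by
  obtain ⟨ω, hω, rfl⟩ := exists_word_of_mem_parabolic cs ha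
  clear ha
  induction ω with
  | nil => simp [T_one]
  | cons i ω ih =>
    have hi := hφI i (hω i List.mem_cons_self)
    have ih := ih fun j hj => hω j (List.mem_cons_of_mem _ hj)
    rw [cs.wordProd_cons, ← T_simple_mul_of_zero cs hi, mul_assoc, ih, T_simple_mul_of_zero cs hi,
      mul_assoc]

theorem T_mul_parabolic (hφI : ∀ i ∈ I, φ i = 0) {a : W} (ha : a ∈ parabolic cs I) (w : W) :
    T cs φ w * T cs φ a = T cs φ (w * a) := by
  obtain ⟨ω, hω, rfl⟩ := exists_word_of_mem_parabolic cs ha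
  clear ha
  induction ω generalizing w with
  | nil => simp [T_one]
  | cons i ω ih =>
    have hi := hφI i (hω i List.mem_cons_self)
    have ih := ih (w := w * cs.simple i) fun j hj => hω j (List.mem_cons_of_mem _ hj)
    rw [cs.wordProd_cons, ← T_simple_mul_of_zero cs hi, ← mul_assoc, T_mul_simple_of_zero cs hi, ih,
      mul_assoc]

theorem bar_T_parabolic (hφI : ∀ i ∈ I, φ i = 0) {a : W} (ha : a ∈ parabolic cs I) :
    bar cs φ (T cs φ a) = T cs φ a := by
  refine (isUnit_T cs φ a⁻¹).mul_right_cancel ?_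
  rw [bar_T_mul, T_parabolic_mul cs hφI ha, mul_inv_cancel, T_one]

variable {Mt : CoxeterMatrix (tildeJ cs I)} (cst : CoxeterSystem Mt (tildeW cs I))

theorem T_tildeJ_eq (hφI : ∀ i ∈ I, φ i = 0) {t : W} {j : B} {a : W} (ha : a ∈ parabolic cs I)
    (ht : t = a * cs.simple j * a⁻¹) :
    T cs φ t = T cs φ a * T cs φ (cs.simple j) * T cs φ a⁻¹ := by
  rw [ht, T_parabolic_mul cs hφI ha, T_mul_parabolic cs hφI (inv_mem ha)]

/-- With `t = a s_j a⁻¹`, the factors `T_a` and `T_{a⁻¹}` multiply freely. Only `T_{s_j} T_{a⁻¹x}`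
needs a length condition, which `isLeftDescent_tilde` supplies. -/
theorem T_tildeJ_mul (hI : ∀ i ∈ I, ∀ j ∉ I, ¬ IsConj (cs.simple i) (cs.simple j))
    (hφI : ∀ i ∈ I, φ i = 0)
    (hst : ∀ t, (cst.simple t : W) = t) (t : tildeJ cs I) (x : tildeW cs I)
    (h : ¬ cst.IsLeftDescent x t) : T cs φ (t : W) * T cs φ x = T cs φ (t * x) := by
  obtain ⟨j, hj, a, ha, ht⟩ := t.2
  have h1 : ¬ cs.IsLeftDescent (a⁻¹ * x) j := fun h1 =>
    h (isLeftDescent_tilde cs cst hI hst hj (a := ⟨a, ha⟩) ht x h1)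
  rw [T_tildeJ_eq cs hφI ha ht, mul_assoc, mul_assoc, T_parabolic_mul cs hφI (inv_mem ha),
    T_simple_mul_of_not_descent cs φ j _ h1, T_parabolic_mul cs hφI ha, ht]
  simp only [mul_assoc]

theorem T_tildeW_mul (hI : ∀ i ∈ I, ∀ j ∉ I, ¬ IsConj (cs.simple i) (cs.simple j))
    (hφI : ∀ i ∈ I, φ i = 0)
    (hst : ∀ t, (cst.simple t : W) = t) (x y : tildeW cs I)
    (h : cst.length (x * y) = cst.length x + cst.length y) :
    T cs φ (x : W) * T cs φ y = T cs φ (x * y) := by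
  induction hn : cst.length x generalizing x with
  | zero =>
    rw [cst.length_eq_zero_iff.1 hn]
    simp [T_one]
  | succ n ih =>
    have hx : x ≠ 1 := by rintro rfl; simp at hn
    obtain ⟨t, ht⟩ := cst.exists_leftDescent_of_ne_one hx
    have ht' := cst.isLeftDescent_iff.1 ht
    obtain ⟨u, rfl⟩ : ∃ u, x = cst.simple t * u := ⟨cst.simple t * x, by simp⟩
    rw [cst.simple_mul_simple_cancel_left] at ht'
    have h1 := cst.length_mul_le u y
    have h2 : cst.length (cst.simple t * u * y) ≤ cst.length (u * y) + 1 := by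
      rw [mul_assoc]
      rcases cst.length_simple_mul (u * y) t with h3 | h3 <;> omega
    have h4 : ¬ cst.IsLeftDescent u t := by
      rw [CoxeterSystem.IsLeftDescent]
      omega
    -- Additivity for `t u` and `y` forces `ℓ(t u y) = ℓ(u y) + 1`.
    have h5 : ¬ cst.IsLeftDescent (u * y) t := by
      rw [CoxeterSystem.IsLeftDescent, ← mul_assoc]
      omega
    have h6 := T_tildeJ_mul cs cst hI hφI hst t u h4
    have h7 := T_tildeJ_mul cs cst hI hφI hst t (u * y) h5
    push_cast at h7 ⊢
    rw [hst, ← h6, mul_assoc, ih u (by omega) (by omega), h7, mul_assoc]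

/-- This is the relation for `s_j` conjugated by the unit `T_a`. -/
theorem T_tildeJ_quad (hφ : IsParameter cs φ) (hφI : ∀ i ∈ I, φ i = 0) (t : tildeJ cs I) :
    (T cs φ (t : W) - E cs φ (tildePhi cs I φ t)) *
      (T cs φ (t : W) + E cs φ (-tildePhi cs I φ t)) = 0 := by
  obtain ⟨j, hj, a, ha, ht⟩ := t.2
  have h1 : T cs φ a⁻¹ * T cs φ a = 1 := by
    rw [T_parabolic_mul cs hφI (inv_mem ha), inv_mul_cancel, T_one]
  have h2 : T cs φ a * T cs φ a⁻¹ = 1 := by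
    rw [T_parabolic_mul cs hφI ha, mul_inv_cancel, T_one]
  have h3 : T cs φ (t : W) - E cs φ (φ j) =
      T cs φ a * (T cs φ (cs.simple j) - E cs φ (φ j)) * T cs φ a⁻¹ := by
    rw [mul_sub, sub_mul, ← T_tildeJ_eq cs hφI ha ht, ← E_comm, mul_assoc, h2, mul_one]
  have h4 : T cs φ (t : W) + E cs φ (-φ j) =
      T cs φ a * (T cs φ (cs.simple j) + E cs φ (-φ j)) * T cs φ a⁻¹ := by
    rw [mul_add, add_mul, ← T_tildeJ_eq cs hφI ha ht, ← E_comm, mul_assoc, h2, mul_one]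
  rw [tildePhi_eq cs I φ hφ t j a ht, h3, h4]
  calc _ = T cs φ a * ((T cs φ (cs.simple j) - E cs φ (φ j)) * ((T cs φ a⁻¹ * T cs φ a) *
        (T cs φ (cs.simple j) + E cs φ (-φ j)))) * T cs φ a⁻¹ := by simp only [mul_assoc]
    _ = 0 := by rw [h1, one_mul, T_quad, mul_zero, zero_mul]

/-- The hypotheses under which the Hecke algebra of `W̃` embeds in the Hecke algebra of `W`. -/
structure IsTildeSetup (φ : B → Γ) : Prop where
  isParameter : IsParameter cs φ
  not_isConj : ∀ i ∈ I, ∀ j ∉ I, ¬ IsConj (cs.simple i) (cs.simple j)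
  eq_zero : ∀ i ∈ I, φ i = 0
  coe_simple : ∀ t, (cst.simple t : W) = t

variable {cs cst}

theorem IsTildeSetup.isParameter_tilde (H : IsTildeSetup cs cst φ) :
    IsParameter cst (tildePhi cs I φ) :=
  isParameter_tildePhi cs H.isParameter cst H.coe_simple

variable (H : IsTildeSetup cs cst φ)

/-- The morphism `H(W̃, J̃, φ̃) → H(W, S, φ)`, `T_x ↦ T_x`. -/
noncomputable def tildeHom :
    Hecke cst (tildePhi cs I φ) →ₐ[GroupRing Γ] Hecke cs φ :=
  RingQuot.liftAlgHom (GroupRing Γ)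
    ⟨FreeAlgebra.lift (GroupRing Γ) (fun x : tildeW cs I => T cs φ (x : W)), by
      intro x y h
      cases h with
      | one => rw [FreeAlgebra.lift_ι_apply, map_one, Subgroup.coe_one, T_one]
      | mul w w' h =>
        rw [map_mul, FreeAlgebra.lift_ι_apply, FreeAlgebra.lift_ι_apply, FreeAlgebra.lift_ι_apply,
          T_tildeW_mul cs cst H.not_isConj H.eq_zero H.coe_simple w w' h, Subgroup.coe_mul]
      | quad t =>
        rw [map_mul, map_sub, map_add, FreeAlgebra.lift_ι_apply, AlgHom.commutes, AlgHom.commutes,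
          map_zero, H.coe_simple]
        exact T_tildeJ_quad cs H.isParameter H.eq_zero t⟩

theorem tildeHom_T (x : tildeW cs I) :
    tildeHom H (T cst (tildePhi cs I φ) x) = T cs φ (x : W) := by
  rw [T, heckeMk, tildeHom]
  erw [RingQuot.liftAlgHom_mkAlgHom_apply]
  rw [FreeAlgebra.lift_ι_apply]

theorem T_mul_tildeHom_T (a : parabolic cs I) (x : tildeW cs I) :
    T cs φ (a : W) * tildeHom H (T cst (tildePhi cs I φ) x) = T cs φ ((a : W) * x) := by
  rw [tildeHom_T, T_parabolic_mul cs H.eq_zero a.2]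

/-- On `T_x`, both sides are the inverse of `T_{x⁻¹}` in `H(W)`. -/
theorem bar_tildeHom (h : Hecke cst (tildePhi cs I φ)) :
    bar cs φ (tildeHom H h) = tildeHom H (bar cst (tildePhi cs I φ) h) := by
  have hh : h ∈ Submodule.span (GroupRing Γ) (Set.range (T cst (tildePhi cs I φ))) := by
    rw [span_T]; trivial
  induction hh using Submodule.span_induction with
  | mem h hx =>
    obtain ⟨x, rfl⟩ := hx
    refine (isUnit_T cs φ (x⁻¹ : tildeW cs I)).mul_right_cancel ?_
    conv_rhs => rw [← tildeHom_T H, ← map_mul, bar_T_mul, map_one]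
    rw [tildeHom_T, Subgroup.coe_inv, bar_T_mul]
  | zero => simp
  | add x y _ _ hx hy => simp only [map_add, hx, hy]
  | smul a x _ hx => rw [map_smul, bar_smul, bar_smul, map_smul, hx]

end TildeHecke

/-! ### Comparison of the two Kazhdan–Lusztig bases -/

section TildeKL

variable {B W : Type*} [Group W] {M : CoxeterMatrix B} {cs : CoxeterSystem M W} {I : Set B}
variable {Γ : Type*} [AddCommGroup Γ] [LinearOrder Γ] {φ : B → Γ}
variable {Mt : CoxeterMatrix (tildeJ cs I)} {cst : CoxeterSystem Mt (tildeW cs I)}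

theorem T_mul_tildeHom_mem_heckeNeg (H : IsTildeSetup cs cst φ) (a : parabolic cs I)
    {h : Hecke cst (tildePhi cs I φ)} (hh : h ∈ heckeNeg cst (tildePhi cs I φ)) :
    T cs φ (a : W) * tildeHom H h ∈ heckeNeg cs φ := by
  induction hh using AddSubgroup.closure_induction with
  | mem h hx =>
    obtain ⟨γ, hγ, x, rfl⟩ := hx
    rw [map_smul, mul_smul_comm, T_mul_tildeHom_T]
    exact AddSubgroup.subset_closure ⟨γ, hγ, _, rfl⟩
  | zero => simp
  | add x y _ _ hx hy => rw [map_add, mul_add]; exact add_mem hx hy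
  | neg x _ hx => rw [map_neg, mul_neg]; exact neg_mem hx

variable [IsOrderedAddMonoid Γ]

/-- The right side is bar-invariant, as both factors are, and congruent to `T_{ax}` because left
multiplication by `T_a` permutes the `T_w`. Uniqueness concludes. -/
theorem KL_mul (H : IsTildeSetup cs cst φ) (a : parabolic cs I) (x : tildeW cs I) :
    KL cs φ ((a : W) * x) = T cs φ (a : W) * tildeHom H (KL cst (tildePhi cs I φ) x) := by
  have h := isKL_KL cst H.isParameter_tilde x
  refine (IsKL.eq_KL cs H.isParameter ⟨?_, ?_⟩).symm
  · rw [map_mul, bar_T_parabolic cs H.eq_zero a.2, bar_tildeHom, h.1]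
  · rw [← T_mul_tildeHom_T H, ← mul_sub, ← map_sub]
    exact T_mul_tildeHom_mem_heckeNeg H a h.2

/-- By `KL_mul`, the decomposition of `H(W)` into the pieces `T_c H(W̃)` respects the
Kazhdan–Lusztig bases. -/
theorem repr_T_mul_tildeHom (H : IsTildeSetup cs cst φ) (c b : parabolic cs I) (x : tildeW cs I)
    (h : Hecke cst (tildePhi cs I φ)) [Decidable (c = b)] :
    (KLBasis cs H.isParameter).repr (T cs φ (c : W) * tildeHom H h) (b * x) =
      if c = b then (KLBasis cst H.isParameter_tilde).repr h x else 0 := by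
  classical
  have hh : h ∈ Submodule.span (GroupRing Γ) (Set.range (KLBasis cst H.isParameter_tilde)) := by
    rw [Module.Basis.span_eq]; trivial
  induction hh using Submodule.span_induction with
  | mem h hx =>
    obtain ⟨y, rfl⟩ := hx
    rw [Module.Basis.repr_self, KLBasis_apply, ← KL_mul, ← KLBasis_apply cs H.isParameter,
      Module.Basis.repr_self, Finsupp.single_apply, Finsupp.single_apply]
    have h1 : ((c : W) * y = b * x) ↔ c = b ∧ y = x := by
      constructor
      · intro h
        have h2 := congrArg (retract cs H.not_isConj) h
        have h3 := congrArg (tildePart cs H.not_isConj) h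
        rw [retract_mul, retract_mul] at h2
        rw [tildePart_mul, tildePart_mul] at h3
        exact ⟨h2, h3⟩
      · rintro ⟨rfl, rfl⟩
        rfl
    simp only [h1, ite_and]
  | zero => simp
  | add x y _ _ hx hy =>
    rw [map_add, mul_add, map_add, Finsupp.add_apply, hx, hy, map_add, Finsupp.add_apply]
    split_ifs <;> simp
  | smul a x _ hx =>
    rw [map_smul, mul_smul_comm, map_smul, Finsupp.smul_apply, hx, map_smul, Finsupp.smul_apply]
    split_ifs <;> simp

end TildeKL

end KLCells

namespace KLCells

/-! ### Bases of cell modules and of their specialisations -/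

section CellModules

variable {B W : Type*} [Group W] {M : CoxeterMatrix B} {cs : CoxeterSystem M W}
variable {Γ : Type*} [AddCommGroup Γ] [LinearOrder Γ] [IsOrderedAddMonoid Γ] {φ : B → Γ}

theorem leftArrow_of_repr_ne_zero (hφ : IsParameter cs φ) {x y : W} (h : Hecke cs φ)
    (hx : (KLBasis cs hφ).repr (h * KL cs φ y) x ≠ 0) : LeftArrow cs φ x y := by
  refine ⟨h, (KLBasis cs hφ).repr (h * KL cs φ y), ?_, hx⟩
  conv_lhs => rw [← (KLBasis cs hφ).linearCombination_repr (h * KL cs φ y)]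
  rw [Finsupp.linearCombination_apply]
  simp only [KLBasis_apply]

theorem leftArrow_iff (hφ : IsParameter cs φ) {x y : W} :
    LeftArrow cs φ x y ↔ ∃ w, (KLBasis cs hφ).repr (T cs φ w * KL cs φ y) x ≠ 0 := by
  constructor
  · rintro ⟨h, a, ha, hx⟩
    have h1 : (KLBasis cs hφ).repr (h * KL cs φ y) = a := by
      have h2 : a.sum (fun z c => c • KL cs φ z) =
          Finsupp.linearCombination (GroupRing Γ) (KLBasis cs hφ) a := by
        rw [Finsupp.linearCombination_apply]
        simp only [KLBasis_apply]
      rw [ha, h2, Module.Basis.repr_linearCombination]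
    by_contra! hc
    apply hx
    rw [← h1]
    have hh : h ∈ Submodule.span (GroupRing Γ) (Set.range (T cs φ)) := by rw [span_T]; trivial
    clear ha h1
    induction hh using Submodule.span_induction with
    | mem h hx =>
      obtain ⟨w, rfl⟩ := hx
      exact hc w
    | zero => simp
    | add x y _ _ hx hy => rw [add_mul, map_add, Finsupp.add_apply, hx, hy, add_zero]
    | smul a x _ hx => rw [smul_mul_assoc, map_smul, Finsupp.smul_apply, hx, smul_zero]
  · rintro ⟨w, hw⟩
    exact leftArrow_of_repr_ne_zero hφ _ hw

theorem leftArrow_refl (hφ : IsParameter cs φ) (x : W) : LeftArrow cs φ x x := by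
  refine leftArrow_of_repr_ne_zero hφ 1 ?_
  rw [one_mul, ← KLBasis_apply cs hφ, Module.Basis.repr_self, Finsupp.single_eq_same]
  exact one_ne_zero

theorem leftLE_refl (hφ : IsParameter cs φ) (x : W) : LeftLE cs φ x x :=
  .single (leftArrow_refl hφ x)

/-- The span of the `C_w` with `w ∈ X`. -/
noncomputable def klSpan (φ : B → Γ) (X : Set W) : Submodule (GroupRing Γ) (Hecke cs φ) :=
  Submodule.span _ (KL cs φ '' X)

theorem mem_klSpan_iff (hφ : IsParameter cs φ) {X : Set W} {h : Hecke cs φ} :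
    h ∈ klSpan φ X ↔ ∀ w, (KLBasis cs hφ).repr h w ≠ 0 → w ∈ X := by
  have h1 : KL cs φ = KLBasis cs hφ := funext fun w => (KLBasis_apply cs hφ w).symm
  rw [klSpan, h1, Module.Basis.mem_span_image]
  simp [Set.subset_def]

/-- A set closed under `←` has a `ℤ[Γ]`-span that is already a left ideal. -/
theorem span_KL_eq (hφ : IsParameter cs φ) {X : Set W}
    (hX : ∀ z w, LeftArrow cs φ z w → w ∈ X → z ∈ X) :
    (Submodule.span (Hecke cs φ) (KL cs φ '' X)).restrictScalars (GroupRing Γ) =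
      klSpan φ X := by
  refine le_antisymm (fun h hh => ?_) (Submodule.span_le_restrictScalars _ _ _)
  have hh : h ∈ Submodule.span (Hecke cs φ) (KL cs φ '' X) := hh
  induction hh using Submodule.span_induction with
  | mem x hx => exact Submodule.subset_span hx
  | zero => exact zero_mem _
  | add x y _ _ hx hy => exact add_mem (hx ‹_›) (hy ‹_›)
  | smul a x _ hx =>
    have hx := hx ‹_›
    rw [smul_eq_mul]
    clear * - hx hX hφ
    induction hx using Submodule.span_induction with
    | mem x hx =>
      obtain ⟨w, hw, rfl⟩ := hx
      rw [mem_klSpan_iff hφ]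
      intro z hz
      exact hX z w (leftArrow_of_repr_ne_zero hφ a hz) hw
    | zero => simp
    | add x y _ _ hx hy => rw [mul_add]; exact add_mem hx hy
    | smul r x _ hx => rw [mul_smul_comm]; exact Submodule.smul_mem _ _ hx

/-- The elements `w` with `w ≤_L C`. -/
def lowerSet (φ : B → Γ) (C : Set W) : Set W := {w | ∃ c ∈ C, LeftLE cs φ w c}

theorem idealLE_eq (hφ : IsParameter cs φ) (C : Set W) :
    (idealLE cs φ C).restrictScalars (GroupRing Γ) = klSpan φ (lowerSet (cs := cs) φ C) := by
  have h : {h | ∃ w : W, (∃ c ∈ C, LeftLE cs φ w c) ∧ h = KL cs φ w} =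
      KL cs φ '' lowerSet (cs := cs) φ C := by
    ext h
    simp only [lowerSet, Set.mem_ofPred_eq, Set.mem_image, eq_comm]
  rw [← span_KL_eq hφ, idealLE, h]
  rintro z w h ⟨c, hc, hw⟩
  exact ⟨c, hc, .head h hw⟩

theorem idealLT_eq (hφ : IsParameter cs φ) {C : Set W} (hC : IsLeftCell cs φ C) :
    (idealLT cs φ C).restrictScalars (GroupRing Γ) = klSpan φ (lowerSet (cs := cs) φ C \ C) := by
  have h : {h | ∃ w : W, ((∃ c ∈ C, LeftLE cs φ w c) ∧ w ∉ C) ∧ h = KL cs φ w} =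
      KL cs φ '' (lowerSet (cs := cs) φ C \ C) := by
    ext h
    simp only [lowerSet, Set.mem_ofPred_eq, Set.mem_image, Set.mem_sdiff, eq_comm]
  rw [← span_KL_eq hφ, idealLT, h]
  obtain ⟨v, rfl⟩ := hC
  rintro z w h ⟨⟨c, hc, hw⟩, hwC⟩
  -- If `z ∈ C` and `z ← w ≤_L C`, then `w` would lie in the cell as well.
  refine ⟨⟨c, hc, .head h hw⟩, fun hz => hwC ⟨hw.trans hc.1, ?_⟩⟩
  exact hz.2.trans (.single h)

theorem subset_lowerSet (hφ : IsParameter cs φ) (C : Set W) : C ⊆ lowerSet (cs := cs) φ C :=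
  fun c hc => ⟨c, hc, leftLE_refl hφ c⟩

theorem KL_mem_idealLE (hφ : IsParameter cs φ) {C : Set W} {c : W} (hc : c ∈ C) :
    KL cs φ c ∈ idealLE cs φ C :=
  Submodule.subset_span ⟨c, subset_lowerSet hφ C hc, rfl⟩

/-- The class of `C_w` in the cell module. -/
noncomputable def cellClass (hφ : IsParameter cs φ) (C : Set W) (c : C) : CellModule cs φ C :=
  Submodule.Quotient.mk ⟨KL cs φ c, KL_mem_idealLE hφ c.2⟩

theorem span_cellClass (hφ : IsParameter cs φ) (C : Set W) :
    Submodule.span (GroupRing Γ) (Set.range (cellClass hφ C)) = ⊤ := by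
  rw [eq_top_iff]
  rintro m -
  obtain ⟨⟨h, hh⟩, rfl⟩ := Submodule.Quotient.mk_surjective _ m
  have hs : h ∈ klSpan φ (lowerSet (cs := cs) φ C) := by
    rw [← idealLE_eq hφ]
    exact hh
  have hle : klSpan φ (lowerSet (cs := cs) φ C) ≤
      (idealLE cs φ C).restrictScalars (GroupRing Γ) := (idealLE_eq hφ C).ge
  induction hs using Submodule.span_induction with
  | mem x hx =>
    obtain ⟨w, hw, rfl⟩ := hx
    by_cases hwC : w ∈ C
    · exact Submodule.subset_span ⟨⟨w, hwC⟩, rfl⟩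
    · have : (Submodule.Quotient.mk ⟨KL cs φ w, hh⟩ : CellModule cs φ C) = 0 := by
        rw [Submodule.Quotient.mk_eq_zero]
        have : KL cs φ w ∈ idealLT cs φ C := Submodule.subset_span ⟨w, ⟨hw, hwC⟩, rfl⟩
        exact this
      rw [this]
      exact zero_mem _
  | zero =>
    have : (⟨0, hh⟩ : idealLE cs φ C) = 0 := rfl
    rw [this, Submodule.Quotient.mk_zero]
    exact zero_mem _
  | add x y hx hy h1 h2 => exact add_mem (h1 (hle hx)) (h2 (hle hy))
  | smul a x hx h1 => exact Submodule.smul_mem _ a (h1 (hle hx))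

/-- The coefficients of an element of the cell module. -/
noncomputable def cellCoord (hφ : IsParameter cs φ) {C : Set W} (hC : IsLeftCell cs φ C) :
    CellModule cs φ C →ₗ[GroupRing Γ] (C →₀ GroupRing Γ) :=
  (((idealLT cs φ C).submoduleOf (idealLE cs φ C)).restrictScalars (GroupRing Γ)).liftQ
    ((Finsupp.lcomapDomain (R := GroupRing Γ) ((↑) : C → W) Subtype.val_injective ∘ₗ
      (KLBasis cs hφ).repr.toLinearMap) ∘ₗ
        ((idealLE cs φ C).restrictScalars (GroupRing Γ)).subtype) (by
    rintro ⟨h, hh⟩ hx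
    have hx : h ∈ (idealLT cs φ C).restrictScalars (GroupRing Γ) := hx
    rw [idealLT_eq hφ hC, mem_klSpan_iff hφ] at hx
    rw [LinearMap.mem_ker]
    ext1 c
    by_contra hc
    exact (hx c hc).2 c.2) ∘ₗ
  (Submodule.Quotient.restrictScalarsEquiv (GroupRing Γ)
    ((idealLT cs φ C).submoduleOf (idealLE cs φ C))).symm.toLinearMap

/-- Together with `span_cellClass`, this makes the classes of the `C_w`, `w ∈ C`, a basis of `M_C`.
-/
theorem cellCoord_cellClass (hφ : IsParameter cs φ) {C : Set W} (hC : IsLeftCell cs φ C) (c : C) :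
    cellCoord hφ hC (cellClass hφ C c) = Finsupp.single c 1 := by
  have h : cellCoord hφ hC (cellClass hφ C c) =
      Finsupp.lcomapDomain (R := GroupRing Γ) ((↑) : C → W) Subtype.val_injective
        ((KLBasis cs hφ).repr (KL cs φ c)) := rfl
  rw [h, ← KLBasis_apply cs hφ, Module.Basis.repr_self]
  classical
  ext1 d
  change Finsupp.single (c : W) (1 : GroupRing Γ) (d : W) = _
  rw [Finsupp.single_apply, Finsupp.single_apply]
  simp only [Subtype.ext_iff]

/-- The basis element `1 ⊗ C_w` of `ℤ M_C`. -/
noncomputable def specClass (hφ : IsParameter cs φ) (C : Set W) (c : C) :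
    AugInt Γ ⊗[GroupRing Γ] CellModule cs φ C :=
  (show AugInt Γ from (1 : ℤ)) ⊗ₜ cellClass hφ C c

theorem spec_hom_ext (hφ : IsParameter cs φ) {C : Set W} {A : Type*} [AddCommGroup A]
    {f g : AugInt Γ ⊗[GroupRing Γ] CellModule cs φ C →+ A}
    (h : ∀ c, f (specClass hφ C c) = g (specClass hφ C c)) : f = g := by
  ext x
  induction x with
  | zero => simp
  | add x y hx hy => rw [map_add, map_add, hx, hy]
  | tmul n m =>
    have hm : m ∈ Submodule.span (GroupRing Γ) (Set.range (cellClass hφ C)) := by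
      rw [span_cellClass]; trivial
    induction hm using Submodule.span_induction generalizing n with
    | mem m hm =>
      obtain ⟨c, rfl⟩ := hm
      have hn : n ⊗ₜ[GroupRing Γ] cellClass hφ C c = (show ℤ from n) • specClass hφ C c := by
        rw [specClass, TensorProduct.smul_tmul']
        congr 1
        exact (mul_one (show ℤ from n)).symm
      rw [hn, map_zsmul, map_zsmul, h]
    | zero => simp
    | add x y _ _ hx hy => rw [TensorProduct.tmul_add, map_add, map_add, hx, hy]
    | smul a x _ hx => rw [← TensorProduct.smul_tmul, hx]

open Classical in
/-- The additive map on `ℤ M_C` with prescribed values on the elements `1 ⊗ C_w`. -/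
noncomputable def specLift (hφ : IsParameter cs φ) {C : Set W} (hC : IsLeftCell cs φ C)
    {A : Type*} [AddCommGroup A] (g : C → A) :
    AugInt Γ ⊗[GroupRing Γ] CellModule cs φ C →+ A :=
  (Finsupp.liftAddHom fun c => (zmultiplesHom A (g c) : ℤ →+ A) : (C →₀ ℤ) →+ A).comp
    ((TensorProduct.finsuppScalarRight (GroupRing Γ) (GroupRing Γ) (AugInt Γ) C).toLinearMap ∘ₗ
      (cellCoord hφ hC).lTensor (AugInt Γ)).toAddMonoidHom

open Classical in
-- With `spec_hom_ext`, this says that `ℤ M_C` is the free abelian group on the `1 ⊗ C_w`, `w ∈ C`.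
theorem specLift_specClass (hφ : IsParameter cs φ) {C : Set W} (hC : IsLeftCell cs φ C)
    {A : Type*} [AddCommGroup A] (g : C → A) (c : C) :
    specLift hφ hC g (specClass hφ C c) = g c := by
  have h : TensorProduct.finsuppScalarRight (GroupRing Γ) (GroupRing Γ) (AugInt Γ) C
      ((cellCoord hφ hC).lTensor (AugInt Γ) (specClass hφ C c)) =
        Finsupp.single c (show AugInt Γ from (1 : ℤ)) := by
    rw [specClass, LinearMap.lTensor_tmul, cellCoord_cellClass]
    refine (TensorProduct.finsuppScalarRight_apply_tmul _ _).trans ?_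
    rw [Finsupp.sum_single_index, one_smul]
    rw [zero_smul, Finsupp.single_zero]
  change Finsupp.liftAddHom (fun c => (zmultiplesHom A (g c) : ℤ →+ A)) _ = _
  erw [h]
  erw [Finsupp.liftAddHom_apply_single]
  simp

end CellModules

end KLCells

namespace KLCells

/-! ### Recognising an induced representation -/

section InducedLift

variable {k G H A A' : Type*} [CommRing k] [Group G] [Group H] [AddCommGroup A] [Module k A]
  [AddCommGroup A'] [Module k A'] (ψ : G →* H) (ρ : Representation k G A)
  (τ : Representation k H A')

/-- The linear map from an induced representation that comes from an equivariant map. -/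
noncomputable def indLift (f : A →ₗ[k] A') (hf : ∀ g a, f (ρ g a) = τ (ψ g) (f a)) :
    Representation.IndV ψ ρ →ₗ[k] A' :=
  Representation.Coinvariants.lift _
    (TensorProduct.lift <| (Finsupp.lift _ _ _ fun h => τ h⁻¹ ∘ₗ f) ∘ₗ
      (MonoidAlgebra.coeffLinearEquiv k).toLinearMap)
    fun g ↦ by
      ext h x
      simp only [LinearMap.coe_comp, Function.comp_apply, MonoidAlgebra.lsingle_apply]
      simp [mul_inv_rev, hf]

/-- The inverse appears because `H` acts on the induced module by right translation by inverses:
`IndV.mk h a` plays the role of `h⁻¹ ⊗ a`. -/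
theorem indLift_mk (f : A →ₗ[k] A') (hf : ∀ g a, f (ρ g a) = τ (ψ g) (f a)) (h : H) (a : A) :
    indLift ψ ρ τ f hf (Representation.IndV.mk ψ ρ h a) = τ h⁻¹ (f a) := by
  simp [indLift]

theorem indLift_ind (f : A →ₗ[k] A') (hf : ∀ g a, f (ρ g a) = τ (ψ g) (f a)) (h : H)
    (x : Representation.IndV ψ ρ) :
    indLift ψ ρ τ f hf (Representation.ind ψ ρ h x) = τ h (indLift ψ ρ τ f hf x) := by
  have : indLift ψ ρ τ f hf ∘ₗ Representation.ind ψ ρ h = τ h ∘ₗ indLift ψ ρ τ f hf := by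
    refine Representation.IndV.hom_ext _ _ fun h' => LinearMap.ext fun a => ?_
    change indLift ψ ρ τ f hf (Representation.ind ψ ρ h (Representation.IndV.mk ψ ρ h' a)) =
      τ h (indLift ψ ρ τ f hf (Representation.IndV.mk ψ ρ h' a))
    rw [Representation.ind_mk, indLift_mk, indLift_mk, mul_inv_rev, inv_inv, map_mul,
      Module.End.mul_apply]
  exact LinearMap.congr_fun this x

theorem indV_mk_mul (g : G) (h : H) (a : A) :
    Representation.IndV.mk ψ ρ (ψ g * h) (ρ g a) = Representation.IndV.mk ψ ρ h a := by
  have := Representation.Coinvariants.mk_self_apply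
    (Representation.tprod ((Representation.leftRegular k H).comp ψ) ρ) g
    (MonoidAlgebra.single h 1 ⊗ₜ a)
  simpa using this

/-- A representation is induced if it has an inverse to `indLift` on the translates of the image
of `f` by coset representatives. -/
noncomputable def equivInd (f : A →ₗ[k] A') (hf : ∀ g a, f (ρ g a) = τ (ψ g) (f a))
    (e : A' →+ Representation.IndV ψ ρ) {ι : Type*} (r : ι → H)
    (hr : ∀ h, ∃ g i, ψ g * h = r i)
    (he : ∀ i a, e (τ (r i)⁻¹ (f a)) = Representation.IndV.mk ψ ρ (r i) a)
    (hext : ∀ u v : A' →+ A',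
      (∀ i a, u (τ (r i)⁻¹ (f a)) = v (τ (r i)⁻¹ (f a))) → u = v) :
    τ.Equiv (Representation.ind ψ ρ) :=
  (Representation.Equiv.mk (LinearEquiv.ofBijective (indLift ψ ρ τ f hf) (by
    -- A generator `mk h a` is moved to a coset representative by `indV_mk_mul`, where `he` computes
    -- `e`.
    have h1 : ∀ x, e (indLift ψ ρ τ f hf x) = x := by
      intro x
      obtain ⟨x, rfl⟩ := Representation.Coinvariants.mk_surjective _ x
      induction x with
      | zero => simp
      | add x y hx hy => rw [map_add, map_add, map_add, hx, hy]
      | tmul x a =>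
        induction x using MonoidAlgebra.induction_linear with
        | zero => simp
        | add x y hx hy => rw [TensorProduct.add_tmul, map_add, map_add, map_add, hx, hy]
        | single h c =>
          have h2 : Representation.Coinvariants.mk
              (Representation.tprod ((Representation.leftRegular k H).comp ψ) ρ)
              (MonoidAlgebra.single h c ⊗ₜ[k] a) = Representation.IndV.mk ψ ρ h (c • a) := by
            have : (MonoidAlgebra.single h c : MonoidAlgebra k H) =
                c • MonoidAlgebra.single h 1 := by simp
            rw [this, TensorProduct.smul_tmul]
            rfl
          obtain ⟨g, i, hi⟩ := hr h
          rw [h2, ← indV_mk_mul ψ ρ g, hi, indLift_mk, he]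
    refine ⟨Function.LeftInverse.injective h1, fun x => ⟨e x, ?_⟩⟩
    have h2 : (indLift ψ ρ τ f hf).toAddMonoidHom.comp e = AddMonoidHom.id A' := by
      refine hext _ _ fun i a => ?_
      change indLift ψ ρ τ f hf (e _) = _
      rw [he, indLift_mk]
      rfl
    exact DFunLike.congr_fun h2 x)) fun h => LinearMap.ext fun x => indLift_ind ψ ρ τ f hf h x).symm

end InducedLift

/-! ### Left cells `W_I C` and the induction isomorphism -/

section TildeCells

variable {B W : Type*} [Group W] {M : CoxeterMatrix B} {cs : CoxeterSystem M W} {I : Set B}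
variable {Γ : Type*} [AddCommGroup Γ] [LinearOrder Γ] [IsOrderedAddMonoid Γ] {φ : B → Γ}
variable {Mt : CoxeterMatrix (tildeJ cs I)} {cst : CoxeterSystem Mt (tildeW cs I)}
theorem T_mul_KL (H : IsTildeSetup cs cst φ) (v : W) (a c : parabolic cs I) (x y : tildeW cs I) (h : v * a = c * y) :
    T cs φ v * KL cs φ (a * x) = T cs φ (c : W) *
      tildeHom H (T cst (tildePhi cs I φ) y * KL cst (tildePhi cs I φ) x) := by
  rw [KL_mul H, ← mul_assoc, T_mul_parabolic cs H.eq_zero a.2, h, map_mul, ← mul_assoc,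
    T_mul_tildeHom_T H]

/-- Components in `W_I` do not affect the relation: `T_v C_{ax} = T_c (T_y C_x)` when `v a = c y`,
and `c` can be chosen freely through `v`. -/
theorem leftArrow_mul_iff (H : IsTildeSetup cs cst φ) (a b : parabolic cs I) (x x' : tildeW cs I) :
    LeftArrow cs φ (b * x') (a * x) ↔ LeftArrow cst (tildePhi cs I φ) x' x := by
  classical
  rw [leftArrow_iff H.isParameter, leftArrow_iff H.isParameter_tilde]
  constructor
  · rintro ⟨v, hv⟩
    refine ⟨tildePart cs H.not_isConj (v * a), fun h => hv ?_⟩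
    rw [T_mul_KL H v a _ x _ (retract_mul_tildePart cs H.not_isConj (v * a)).symm,
      repr_T_mul_tildeHom H, h, ite_self]
  · rintro ⟨y, hy⟩
    -- This `v` is chosen so that `v a = b y`, which puts the product in the piece indexed by `b`.
    refine ⟨b * y * (a : W)⁻¹, ?_⟩
    rwa [T_mul_KL H _ a b x y (by group), repr_T_mul_tildeHom H, if_pos rfl]

theorem leftArrow_tildePart_iff (H : IsTildeSetup cs cst φ) (w w' : W) :
    LeftArrow cst (tildePhi cs I φ) (tildePart cs H.not_isConj w) (tildePart cs H.not_isConj w') ↔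
      LeftArrow cs φ w w' := by
  rw [← leftArrow_mul_iff H (retract cs H.not_isConj w') (retract cs H.not_isConj w),
    retract_mul_tildePart, retract_mul_tildePart]

theorem leftLE_tildePart_iff (H : IsTildeSetup cs cst φ) (w w' : W) :
    LeftLE cst (tildePhi cs I φ) (tildePart cs H.not_isConj w) (tildePart cs H.not_isConj w') ↔
      LeftLE cs φ w w' := by
  constructor
  · intro h
    generalize hx : tildePart cs H.not_isConj w = x at h
    generalize hy : tildePart cs H.not_isConj w' = y at h
    unfold LeftLE at h
    induction h generalizing w' with
    | single h =>
      rw [← hx, ← hy, leftArrow_tildePart_iff H] at h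
      exact .single h
    -- Intermediate elements of a chain in `W̃` are viewed in `W`, where each is its own component
    -- in `W̃`.
    | @tail b c _ h ih =>
      refine (ih (b : W) (tildePart_coe cs H.not_isConj b)).tail ?_
      rwa [← leftArrow_tildePart_iff H, tildePart_coe, hy]
  · intro h
    exact Relation.TransGen.lift _ (fun a b hab => (leftArrow_tildePart_iff H a b).2 hab) _ _ h

theorem isLeftCell_parabolic_mul (H : IsTildeSetup cs cst φ) {C : Set (tildeW cs I)}
    (hC : IsLeftCell cst (tildePhi cs I φ) C) :
    IsLeftCell cs φ ((parabolic cs I : Set W) * ((↑) '' C : Set W)) := by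
  obtain ⟨y, rfl⟩ := hC
  refine ⟨y, Set.ext fun w => ?_⟩
  rw [mem_parabolic_mul_iff cs H.not_isConj]
  have h := tildePart_coe cs H.not_isConj y
  change (LeftLE _ _ _ _ ∧ LeftLE _ _ _ _) ↔ (LeftLE _ _ _ _ ∧ LeftLE _ _ _ _)
  rw [← leftLE_tildePart_iff H, ← leftLE_tildePart_iff H, h]

variable (H : IsTildeSetup cs cst φ)

/-- `tildeHom` as a semilinear map over itself. -/
noncomputable def tildeHomSemilinear :
    Hecke cst (tildePhi cs I φ) →ₛₗ[(tildeHom H : Hecke cst (tildePhi cs I φ) →+* Hecke cs φ)]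
      Hecke cs φ where
  toFun := tildeHom H
  map_add' := map_add _
  map_smul' a h := map_mul (tildeHom H) a h

theorem tildeHom_KL (x : tildeW cs I) :
    tildeHom H (KL cst (tildePhi cs I φ) x) = KL cs φ (x : W) := by
  have := KL_mul H 1 x
  rw [Subgroup.coe_one, one_mul, T_one, one_mul] at this
  exact this.symm

theorem idealLE_le_comap (C : Set (tildeW cs I)) :
    idealLE cst (tildePhi cs I φ) C ≤
      (idealLE cs φ ((parabolic cs I : Set W) * ((↑) '' C : Set W))).comap
        (tildeHomSemilinear H) := by
  refine Submodule.span_le.2 ?_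
  rintro - ⟨x, ⟨c, hc, hx⟩, rfl⟩
  refine Submodule.subset_span ⟨x, ⟨c, ?_, ?_⟩, tildeHom_KL H x⟩
  · rwa [mem_parabolic_mul_iff cs H.not_isConj, tildePart_coe]
  · rwa [← leftLE_tildePart_iff H, tildePart_coe, tildePart_coe]

theorem idealLT_le_comap (C : Set (tildeW cs I)) :
    idealLT cst (tildePhi cs I φ) C ≤
      (idealLT cs φ ((parabolic cs I : Set W) * ((↑) '' C : Set W))).comap
        (tildeHomSemilinear H) := by
  refine Submodule.span_le.2 ?_
  rintro - ⟨x, ⟨⟨c, hc, hx⟩, hxC⟩, rfl⟩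
  refine Submodule.subset_span ⟨x, ⟨⟨c, ?_, ?_⟩, ?_⟩, tildeHom_KL H x⟩
  · rwa [mem_parabolic_mul_iff cs H.not_isConj, tildePart_coe]
  · rwa [← leftLE_tildePart_iff H, tildePart_coe, tildePart_coe]
  · rwa [mem_parabolic_mul_iff cs H.not_isConj, tildePart_coe]

/-- The restriction of `tildeHom` to the left ideals `H_{≤ C}`. -/
noncomputable def idealLEMap (C : Set (tildeW cs I)) :
    idealLE cst (tildePhi cs I φ) C
      →ₛₗ[(tildeHom H : Hecke cst (tildePhi cs I φ) →+* Hecke cs φ)]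
      idealLE cs φ ((parabolic cs I : Set W) * ((↑) '' C : Set W)) where
  toFun h := ⟨tildeHom H h, idealLE_le_comap H C h.2⟩
  map_add' _ _ := Subtype.ext (map_add (tildeHom H) _ _)
  map_smul' _ _ := Subtype.ext (map_mul (tildeHom H) _ _)

/-- The map between cell modules induced by `tildeHom`. -/
noncomputable def cellMap (C : Set (tildeW cs I)) :
    CellModule cst (tildePhi cs I φ) C
      →ₛₗ[(tildeHom H : Hecke cst (tildePhi cs I φ) →+* Hecke cs φ)]
      CellModule cs φ ((parabolic cs I : Set W) * ((↑) '' C : Set W)) :=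
  Submodule.mapQ _ _ (idealLEMap H C) fun _ hx => idealLT_le_comap H C hx

/-- `cellMap` as a `ℤ[Γ]`-linear map. -/
noncomputable def cellMapLinear (C : Set (tildeW cs I)) :
    CellModule cst (tildePhi cs I φ) C →ₗ[GroupRing Γ]
      CellModule cs φ ((parabolic cs I : Set W) * ((↑) '' C : Set W)) where
  toFun := cellMap H C
  map_add' := map_add _
  map_smul' a m := by
    rw [← algebraMap_smul (Hecke cst (tildePhi cs I φ)) a m, LinearMap.map_smulₛₗ,
      RingHom.coe_coe, AlgHom.commutes, algebraMap_smul]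
    rfl

/-- The map `ℤ M_C → ℤ M_{W_I C}`. -/
noncomputable def specCellMap (C : Set (tildeW cs I)) :
    AugInt Γ ⊗[GroupRing Γ] CellModule cst (tildePhi cs I φ) C →ₗ[ℤ]
      AugInt Γ ⊗[GroupRing Γ] CellModule cs φ ((parabolic cs I : Set W) * ((↑) '' C : Set W)) :=
  ((cellMapLinear H C).lTensor (AugInt Γ)).toAddMonoidHom.toIntLinearMap

theorem specCellMap_equivariant (C : Set (tildeW cs I)) (x : tildeW cs I)
    (v : AugInt Γ ⊗[GroupRing Γ] CellModule cst (tildePhi cs I φ) C) :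
    specCellMap H C (cellRep cst (tildePhi cs I φ) C x v) =
      cellRep cs φ _ ((tildeW cs I).subtype x) (specCellMap H C v) := by
  induction v with
  | zero => simp
  | add u v hu hv => simp only [map_add, hu, hv]
  | tmul n m =>
    change n ⊗ₜ cellMap H C (T cst (tildePhi cs I φ) x • m) =
      n ⊗ₜ (T cs φ (x : W) • cellMap H C m)
    rw [LinearMap.map_smulₛₗ, RingHom.coe_coe, tildeHom_T]

theorem mul_mem_parabolic_mul {C : Set (tildeW cs I)} (a : parabolic cs I) (x : C) :
    (a : W) * (x : tildeW cs I) ∈ (parabolic cs I : Set W) * ((↑) '' C : Set W) :=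
  Set.mul_mem_mul a.2 ⟨x, x.2, rfl⟩

/-- This is `KL_mul` read in the cell module; it exhibits the basis of `ℤ M_{W_I C}` as the
`W_I`-translates of that of `ℤ M_C`. -/
theorem cellRep_specCellMap_specClass (C : Set (tildeW cs I)) (a : parabolic cs I) (x : C) :
    cellRep cs φ _ (a : W) (specCellMap H C (specClass H.isParameter_tilde C x)) =
      specClass H.isParameter _ ⟨_, mul_mem_parabolic_mul a x⟩ := by
  have h : T cs φ (a : W) • cellMap H C (cellClass H.isParameter_tilde C x) =
      cellClass H.isParameter _ ⟨_, mul_mem_parabolic_mul a x⟩ := by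
    refine congrArg Submodule.Quotient.mk (Subtype.ext ?_)
    exact (KL_mul H a x).symm
  exact congrArg (fun m => (show AugInt Γ from (1 : ℤ)) ⊗ₜ[GroupRing Γ] m) h

/-- The map from `ℤ M_{W_I C}` to the induced representation. -/
noncomputable def cellToInd {C : Set (tildeW cs I)} (hC : IsLeftCell cst (tildePhi cs I φ) C) :
    AugInt Γ ⊗[GroupRing Γ] CellModule cs φ ((parabolic cs I : Set W) * ((↑) '' C : Set W)) →+
      Representation.IndV (tildeW cs I).subtype (cellRep cst (tildePhi cs I φ) C) :=
  specLift H.isParameter (isLeftCell_parabolic_mul H hC) fun w =>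
    Representation.IndV.mk (tildeW cs I).subtype (cellRep cst (tildePhi cs I φ) C)
      (retract cs H.not_isConj (w : W) : W)⁻¹
      (specClass H.isParameter_tilde C
        ⟨tildePart cs H.not_isConj (w : W), (mem_parabolic_mul_iff cs H.not_isConj C w).1 w.2⟩)

theorem cellToInd_specClass {C : Set (tildeW cs I)} (hC : IsLeftCell cst (tildePhi cs I φ) C)
    (a : parabolic cs I) (x : C) :
    cellToInd H hC (specClass H.isParameter _ ⟨_, mul_mem_parabolic_mul a x⟩) =
      Representation.IndV.mk (tildeW cs I).subtype (cellRep cst (tildePhi cs I φ) C) (a : W)⁻¹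
        (specClass H.isParameter_tilde C x) := by
  rw [cellToInd, specLift_specClass]
  simp only [retract_mul, tildePart_mul]

theorem cellToInd_cellRep {C : Set (tildeW cs I)} (hC : IsLeftCell cst (tildePhi cs I φ) C)
    (a : parabolic cs I)
    (v : AugInt Γ ⊗[GroupRing Γ] CellModule cst (tildePhi cs I φ) C) :
    cellToInd H hC (cellRep cs φ _ (a : W) (specCellMap H C v)) =
      Representation.IndV.mk (tildeW cs I).subtype (cellRep cst (tildePhi cs I φ) C) (a : W)⁻¹
        v := by
  have h : ((cellToInd H hC).comp (cellRep cs φ _ (a : W)).toAddMonoidHom).comp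
      (specCellMap H C).toAddMonoidHom = (Representation.IndV.mk (tildeW cs I).subtype
        (cellRep cst (tildePhi cs I φ) C) (a : W)⁻¹).toAddMonoidHom :=
    spec_hom_ext H.isParameter_tilde fun x =>
      (congrArg (cellToInd H hC) (cellRep_specCellMap_specClass H C a x)).trans
        (cellToInd_specClass H hC a x)
  exact DFunLike.congr_fun h v

/-- The isomorphism `ℤ M_{W_I C} ≃ Ind ℤ M_C`. -/
noncomputable def cellRepEquivInd {C : Set (tildeW cs I)}
    (hC : IsLeftCell cst (tildePhi cs I φ) C) :
    (cellRep cs φ ((parabolic cs I : Set W) * ((↑) '' C : Set W))).Equiv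
      (Representation.ind (tildeW cs I).subtype (cellRep cst (tildePhi cs I φ) C)) :=
  equivInd _ _ _ (specCellMap H C) (specCellMap_equivariant H C) (cellToInd H hC)
    -- Representatives are inverted to match `IndV.mk`. If `h⁻¹ = a x` with `a ∈ W_I` and `x ∈ W̃`,
    -- then `x h = a⁻¹`.
    (fun a : parabolic cs I => (a : W)⁻¹)
    (fun h => ⟨tildePart cs H.not_isConj h⁻¹, retract cs H.not_isConj h⁻¹, by
      rw [← inv_inj, mul_inv_rev, inv_inv, Subgroup.subtype_apply,
        ← eq_mul_inv_iff_mul_eq.2 (retract_mul_tildePart cs H.not_isConj h⁻¹)]⟩)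
    (fun a v => by
      rw [inv_inv]
      exact cellToInd_cellRep H hC a v)
    (fun u v huv => spec_hom_ext H.isParameter fun w => by
      obtain ⟨w, hw⟩ := w
      obtain ⟨a, ha, -, ⟨x, hx, rfl⟩, rfl⟩ := hw
      have h := huv ⟨a, ha⟩ (specClass H.isParameter_tilde C ⟨x, hx⟩)
      rw [inv_inv] at h
      have h1 := cellRep_specCellMap_specClass H C ⟨a, ha⟩ ⟨x, hx⟩
      exact ((congrArg u h1).symm.trans h).trans (congrArg v h1))

end TildeCells

end KLCells

theorem mainTheorem11 {B W : Type*} [Group W] {M : CoxeterMatrix B} (cs : CoxeterSystem M W)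
    {Γ : Type*} [AddCommGroup Γ] [LinearOrder Γ] [IsOrderedAddMonoid Γ]
    (φ : B → Γ) (hφ : KLCells.IsParameter cs φ)
    (I : Set B) (hI : ∀ i ∈ I, ∀ j ∉ I, ¬ IsConj (cs.simple i) (cs.simple j))
    (hφI : ∀ i ∈ I, φ i = 0) :
    ∃ (Mt : CoxeterMatrix (KLCells.tildeJ cs I))
      (cst : CoxeterSystem Mt (KLCells.tildeW cs I)),
      (∀ t : KLCells.tildeJ cs I, (cst.simple t : W) = t) ∧
      KLCells.IsParameter cst (KLCells.tildePhi cs I φ) ∧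
      ∀ C : Set (KLCells.tildeW cs I),
        KLCells.IsLeftCell cst (KLCells.tildePhi cs I φ) C →
          KLCells.IsLeftCell cs φ
            ((KLCells.parabolic cs I : Set W) * ((↑) '' C : Set W)) ∧
          Nonempty ((KLCells.cellRep cs φ
              ((KLCells.parabolic cs I : Set W) * ((↑) '' C : Set W))).Equiv
            (Representation.ind (KLCells.tildeW cs I).subtype
              (KLCells.cellRep cst (KLCells.tildePhi cs I φ) C))) := by
  have H : KLCells.IsTildeSetup cs (KLCells.tildeSystem cs hI) φ :=
    ⟨hφ, hI, hφI, KLCells.coe_tildeSystem_simple cs hI⟩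
  exact ⟨_, KLCells.tildeSystem cs hI, H.coe_simple, H.isParameter_tilde, fun C hC =>
    ⟨KLCells.isLeftCell_parabolic_mul H hC, ⟨KLCells.cellRepEquivInd H hC⟩⟩⟩
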